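/- **Setting.** Trees are defined recursively from a set of leaves: every leaf $\ell$ is a tree with $L(\ell)=\{\ell\}$, and if $m\ge 2$ and $\tau_1,\dots,\tau_m$ are trees with pairwise disjoint leaf sets, then $\tau=(\tau_1,\dots,\tau_m)$ is a tree with $L(\tau)=\bigcup_i L(\tau_i)$. Fix a tree $\bar\tau$, dimensions $n_\ell$ for its leaves and ranks $r_\tau$ for its subtrees $\tau\le\bar\tau$, with $r_{\bar\tau}=1$. Put $n_\tau=\prod_i n_{\tau_i}$ and $\mathcal V_\tau=\mathbb R^{r_\tau\times n_{\tau_1}\times\dots\times n_{\tau_m}}$ for $\tau=(\tau_1,\dots,\tau_m)$, and $\mathcal V_\ell=\mathbb R^{r_\ell\times n_\ell}$, with the Euclidean norm of the entries. $\mathrm{Mat}_i$ is the matricization in mode $i$ (modes are counted from $0$), $\mathrm{Ten}_i$ its inverse, and $\times_i$ the mode-$i$ product. A tree tensor network (TTN) in factorized form consists of a matrix $U_\ell\in\mathbb R^{n_\ell\times r_\ell}$ for each leaf and a connection tensor $C_\tau\in\mathbb R^{r_\tau\times r_{\tau_1}\times\dots\times r_{\tau_m}}$ for each other subtree. It represents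 $X_{\bar\tau}$, where recursively $X_\ell=U_\ell^\top$, $X_\tau=C_\tau\times_1U_{\tau_1}\cdots\times_mU_{\tau_m}\in\mathcal V_\tau$ and $U_\tau=\mathrm{Mat}_0(X_\tau)^\top$. It has full tree rank if all $U_\ell$ have rank $r_\ell$ and all $C_\tau$ have multilinear rank $(r_\tau,r_{\tau_1},\dots,r_{\tau_m})$, and it is orthonormal if $U_\sigma$ has orthonormal columns for all $\sigma<\bar\tau$. Let $\mathcal V=\mathcal V_{\bar\tau}$, let $\mathcal M\subset\mathcal V$ be the manifold of tensors represented by an orthonormal TTN of full tree rank, and let $P(Y)$ be the orthogonal projection of $\mathcal V$ onto the tangent space $T_Y\mathcal M$. **The integrator.** One step from $t_0$ to $t_1$ on $\tau$ for a function $F_\tau(t,\cdot):\mathcal V_\tau\to\mathcal V_\tau$ and a TTN $Y_\tau^0$ on $\tau$ in factorized form, with orthonormal $U_\sigma$ for $\sigma<\tau$: if $\tau$ is a leaf, solve $\dot Y=F_\tau(t,Y)$, $Y(t_0)=Y_\tau^0$, and return $Y(t_1)$. If $\tau=(\tau_1,\dots,\tau_m)$, do for $i=1,\dots,m$ the following,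 where $C_\tau$, $U_{\tau_j}$ denote the current factors: 1. Decompose $\mathrm{Mat}_i(C_\tau)^\top=Q\,S_0^\top$ with $Q^\top Q=I$ and $S_0\in\mathbb R^{r_{\tau_i}\times r_{\tau_i}}$. Put $V=\mathrm{Mat}_i\bigl(\mathrm{Ten}_i(Q^\top)\times_{j\ne i}U_{\tau_j}\bigr)^\top$ (products over $j\in\{1,\dots,m\}\setminus\{i\}$) and $F_{\tau_i}=\pi^\dagger\circ F_\tau\circ\pi$, with $\pi(Y)=\mathrm{Ten}_i\bigl((V\,\mathrm{Mat}_0(Y))^\top\bigr)$ and $\pi^\dagger(Z)=\mathrm{Ten}_0\bigl((\mathrm{Mat}_i(Z)V)^\top\bigr)$. 2. Apply the step on $\tau_i$ recursively to $F_{\tau_i}$ and the initial value $X_{\tau_i}\times_0S_0^\top$, multiplying only the root factor of $X_{\tau_i}$ by $S_0^\top$. 3. In the result, decompose the root factor ($C_{\tau_i}$, or $U_{\tau_i}$ if $\tau_i$ is a leaf) as $\mathrm{Mat}_0(C_{\tau_i})^\top=\widehat Q\,\widehat S$ (or $U_{\tau_i}=\widehat Q\widehat S$) with $\widehat Q^\top\widehat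 Q=I$ and $\widehat S$ square, and replace it by $\mathrm{Ten}_0(\widehat Q^\top)$ (or $\widehat Q$). This gives the new TTN $X_{\tau_i}$ and the new $U_{\tau_i}=\mathrm{Mat}_0(X_{\tau_i})^\top$. 4. Solve $\dot S=-U_{\tau_i}^\top\,\mathrm{Mat}_0\bigl(F_{\tau_i}(t,X_{\tau_i}\times_0S^\top)\bigr)^\top$, $S(t_0)=\widehat S$, and replace $C_\tau$ by $\mathrm{Ten}_i(S(t_1)Q^\top)$. Finally solve $\dot C=F_\tau\bigl(t,C\times_1U_{\tau_1}\cdots\times_mU_{\tau_m}\bigr)\times_1U_{\tau_1}^\top\cdots\times_mU_{\tau_m}^\top$, with $C(t_0)$ the current $C_\tau$, and replace $C_\tau$ by $C(t_1)$. Any choice of the orthogonal decompositions is allowed. **Theorem 6.1 (error bound).** For every tree $\bar\tau$ and all real $L,B,t^*$ there are constants $c_0,c_1,c_2$, depending only on $L$, $B$, $t^*$ and $\bar\tau$ (in particular not on the dimensions, the ranks, or the singular values of matricizations of the connection tensors), such that the following holds for all dimensions $(n_\ell)$ and ranks $(r_\tau)$ with $r_{\bar\tau}=1$, and all $F:[0,t^*]\times\mathcal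 V\to\mathcal V$, $A:[0,t^*]\to\mathcal V$, $\varepsilon\ge0$, $\delta$, $h>0$ and $\alpha<\rho$. Assume: * $\dot A(t)=F(t,A(t))$ and $\|A(t)\|\le\alpha$ for $0\le t\le t^*$; * $\|F(t,Y)-F(t,\widetilde Y)\|\le L\|Y-\widetilde Y\|$ for all $t\in[0,t^*]$ and $Y,\widetilde Y\in\overline{\mathcal M}\cup\{A(t)\}$, where $\overline{\mathcal M}$ is the closure of $\mathcal M$; * $\|F(t,Y)\|\le B$ for all $t\in[0,t^*]$ and $Y\in\mathcal M$; * $\|F(t,Y)-P(Y)F(t,Y)\|\le\varepsilon$ for all $t\in[0,t^*]$ and all $Y\in\mathcal M$ with $\|Y\|\le\rho$; * $Y^0\in\mathcal M$, given by an orthonormal TTN of full tree rank, satisfies $\|Y^0-A(0)\|\le\delta$; * $\alpha+c_0\delta+c_1\varepsilon+c_2h\le\rho$. Then, if $Y^n$ is obtained from $Y^0$ by $n$ steps of the integrator on $\bar\tau$ for $F$, the $k$-th from $(k-1)h$ to $kh$, and $t_n=nh\le t^*$, $$\|Y^n-A(t_n)\|\le c_0\delta+c_1\varepsilon+c_2h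 .$$ -/

import Mathlib

open Set

noncomputable section

namespace TreeTN

/-! ### Trees -/

/-- Ordered trees over a set `𝓛` of leaves: a leaf, or an ordered tuple of trees. -/
inductive OTree (𝓛 : Type*) where
  | leaf (l : 𝓛) : OTree 𝓛
  | node (m : ℕ) (c : Fin m → OTree 𝓛) : OTree 𝓛

variable {𝓛 : Type*}

/-- The set `L(τ)` of leaves of a tree. -/
def OTree.leaves : OTree 𝓛 → Set 𝓛
  | .leaf l => {l}
  | .node _ c => ⋃ i, (c i).leaves

/-- Every vertex that is not a leaf has at least two direct subtrees, and these have pairwise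
disjoint sets of leaves.  (Hence the subtrees at different vertices are different trees, so that a
quantity attached to the vertices is the same thing as a function of the subtree.) -/
def OTree.IsValid : OTree 𝓛 → Prop
  | .leaf _ => True
  | .node m c => 2 ≤ m ∧ (∀ i j, i ≠ j → Disjoint (c i).leaves (c j).leaves) ∧
      ∀ i, (c i).IsValid

/-! ### Tensors -/

/-- Index set of cardinality `n_τ`: one index in `{1, …, n_l}` for each leaf `l` of `τ`,
grouped according to the direct subtrees. -/
def Idx (n : 𝓛 → ℕ) : OTree 𝓛 → Type
  | .leaf l => Fin (n l)
  | .node m c => (i : Fin m) → Idx n (c i)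

instance Idx.instFintype (n : 𝓛 → ℕ) : (τ : OTree 𝓛) → Fintype (Idx n τ)
  | .leaf l => inferInstanceAs (Fintype (Fin (n l)))
  | .node m c =>
    haveI : ∀ i, Fintype (Idx n (c i)) := fun i => Idx.instFintype n (c i)
    inferInstanceAs (Fintype ((i : Fin m) → Idx n (c i)))

/-- The space `𝒱_τ = ℝ^{r_τ × n_{τ₁} × ⋯ × n_{τₘ}}` with the Euclidean norm of the entries. -/
abbrev V (n : 𝓛 → ℕ) (r : OTree 𝓛 → ℕ) (τ : OTree 𝓛) : Type :=
  EuclideanSpace ℝ (Fin (r τ) × Idx n τ)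

/-- The space `ℝ^{r_τ × r_{τ₁} × ⋯ × r_{τₘ}}` of connection tensors at `τ = (τ₁, …, τₘ)`. -/
abbrev Core (r : OTree 𝓛 → ℕ) {m : ℕ} (c : Fin m → OTree 𝓛) : Type :=
  EuclideanSpace ℝ (Fin (r (.node m c)) × ((i : Fin m) → Fin (r (c i))))

section Mat

variable {α β : Type*}

/-- The matricization `Mat₀` in the mode `0`. -/
def mat₀ (T : EuclideanSpace ℝ (α × β)) : Matrix α β ℝ :=
  Matrix.of fun a b => T (a, b)

/-- The inverse operation `Ten₀` of `mat₀`. -/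
def ten₀ (M : Matrix α β ℝ) : EuclideanSpace ℝ (α × β) := WithLp.toLp 2 fun p => M p.1 p.2

variable {m : ℕ} {γ : Fin m → Type*}

/-- The matricization `Matᵢ` in the mode `i ∈ {1, …, m}` of a tensor with modes `0, 1, …, m`. -/
def mat (i : Fin m) (T : EuclideanSpace ℝ (α × ((j : Fin m) → γ j))) :
    Matrix (γ i) (α × ((j : {j // j ≠ i}) → γ j)) ℝ :=
  Matrix.of fun k p => T (p.1, (Equiv.piSplitAt i γ).symm (k, p.2))

/-- The inverse operation `Tenᵢ` of `mat i`. -/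
def ten (i : Fin m) (M : Matrix (γ i) (α × ((j : {j // j ≠ i}) → γ j)) ℝ) :
    EuclideanSpace ℝ (α × ((j : Fin m) → γ j)) :=
  WithLp.toLp 2 fun p => M (p.2 i) (p.1, fun j => p.2 j)

variable {κ : Fin m → Type*}

/-- The Tucker product `C ×₀ I ×₁ U₁ ⋯ ×ₘ Uₘ`. -/
def tucker [∀ j, Fintype (κ j)] (C : EuclideanSpace ℝ (α × ((j : Fin m) → κ j)))
    (U : (j : Fin m) → Matrix (γ j) (κ j) ℝ) : EuclideanSpace ℝ (α × ((j : Fin m) → γ j)) :=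
  WithLp.toLp 2 fun p => ∑ l : (j : Fin m) → κ j, C (p.1, l) * ∏ j, U j (p.2 j) (l j)

/-- `Matᵢ (Tenᵢ (Qᵀ) ×₀ I ×_{j ≠ i} Uⱼ)ᵀ`, the matrix called `V_{τᵢ}⁰`. -/
def vMat [∀ j, Fintype (κ j)] (i : Fin m) (Q : Matrix (α × ((j : {j // j ≠ i}) → κ j)) (κ i) ℝ)
    (U : (j : Fin m) → Matrix (γ j) (κ j) ℝ) :
    Matrix (α × ((j : {j // j ≠ i}) → γ j)) (κ i) ℝ :=
  Matrix.of fun p b =>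
    ∑ l : (j : {j // j ≠ i}) → κ j, Q (p.1, l) b * ∏ j : {j // j ≠ i}, U j (p.2 j) (l j)

end Mat

/-! ### Tree tensor networks -/

/-- Tree tensor networks in factorized form: a basis matrix for every leaf and a connection tensor
for every other vertex. -/
inductive TTN (n : 𝓛 → ℕ) (r : OTree 𝓛 → ℕ) : OTree 𝓛 → Type _ where
  | leaf {l : 𝓛} (U : Matrix (Fin (n l)) (Fin (r (.leaf l))) ℝ) : TTN n r (.leaf l)
  | node {m : ℕ} {c : Fin m → OTree 𝓛} (C : Core r c) (D : (i : Fin m) → TTN n r (c i)) :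
      TTN n r (.node m c)

namespace TTN

variable {n : 𝓛 → ℕ} {r : OTree 𝓛 → ℕ}

/-- The connection tensor at the root. -/
def core {m : ℕ} {c : Fin m → OTree 𝓛} : TTN n r (.node m c) → Core r c
  | .node C _ => C

/-- The networks on the direct subtrees. -/
def child {m : ℕ} {c : Fin m → OTree 𝓛} : TTN n r (.node m c) → (i : Fin m) → TTN n r (c i)
  | .node _ D => D

/-- The matrix `U_τ ∈ ℝ^{n_τ × r_τ}`: the basis matrix if `τ` is a leaf, and otherwise
`U_τ = Mat₀(X_τ)ᵀ` with `X_τ = C_τ ×₀ I ×ᵢ U_{τᵢ}`. -/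
def basis : {τ : OTree 𝓛} → TTN n r τ → Matrix (Idx n τ) (Fin (r τ)) ℝ
  | _, .leaf U => U
  | .node m c, .node C D =>
      (mat₀ (β := (i : Fin m) → Idx n (c i)) (tucker C fun i => (D i).basis)).transpose

/-- The tensor `X_τ ∈ 𝒱_τ` represented by the network. -/
def tensor {τ : OTree 𝓛} (D : TTN n r τ) : V n r τ := ten₀ D.basis.transpose

/-- The leaf matrices have full rank, and the connection tensors have full multilinear rank. -/
def FullRank : {τ : OTree 𝓛} → TTN n r τ → Prop
  | .leaf l, .leaf U => U.rank = r (.leaf l)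
  | .node m c, .node C D => (mat₀ C).rank = r (.node m c) ∧
      (∀ i, (mat i C).rank = r (c i)) ∧ ∀ i, (D i).FullRank

/-- The network is orthonormal: `U_σ` has orthonormal columns for every subtree `σ < τ`. -/
def Orthonormal : {τ : OTree 𝓛} → TTN n r τ → Prop
  | _, .leaf _ => True
  | _, .node _ D => ∀ i, (D i).basis.transpose * (D i).basis = 1 ∧ (D i).Orthonormal

/-- The network in which the factor at the root is multiplied in its mode `0` by `Sᵀ`; the tensor
`X` is changed to `X ×₀ Sᵀ`, and the matrix `U` to `U S`. -/
def mulTop : {τ : OTree 𝓛} → TTN n r τ → Matrix (Fin (r τ)) (Fin (r τ)) ℝ → TTN n r τ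
  | _, .leaf U, S => .leaf (U * S)
  | _, .node C D, S => .node (ten₀ (S.transpose * mat₀ C)) D

/-- The factor at the root has orthonormal columns (`Mat₀(C_τ)ᵀ`, or `U_l` for a leaf). -/
def TopOrthonormal : {τ : OTree 𝓛} → TTN n r τ → Prop
  | _, .leaf U => U.transpose * U = 1
  | _, .node C _ => mat₀ C * (mat₀ C).transpose = 1

end TTN

/-- The manifold `ℳ_τ` of tensors that have an orthonormal tree tensor network representation
of the given dimensions and of full tree rank. -/
def manifold (n : 𝓛 → ℕ) (r : OTree 𝓛 → ℕ) (τ : OTree 𝓛) : Set (V n r τ) :=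
  {Y | ∃ D : TTN n r τ, D.FullRank ∧ D.Orthonormal ∧ D.tensor = Y}

/-- The tangent space of a submanifold `M` of `E` at `Y`: (the span of) the velocities of the
curves in `M` through `Y`. -/
def tangent {E : Type*} [NormedAddCommGroup E] [NormedSpace ℝ E] (M : Set E) (Y : E) :
    Submodule ℝ E :=
  Submodule.span ℝ {v | ∃ x : ℝ → E, (∀ᶠ s in nhds 0, x s ∈ M) ∧ x 0 = Y ∧ HasDerivAt x v 0}

/-! ### The integrator -/

/-- `y₁` is the value at `t₁` of a solution of `ẏ = f(t, y)`, `y(t₀) = y₀`, on `[t₀, t₁]`. -/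
def Solves {E : Type*} [NormedAddCommGroup E] [NormedSpace ℝ E] (f : ℝ → E → E) (t₀ t₁ : ℝ)
    (y₀ y₁ : E) : Prop :=
  ∃ y : ℝ → E, y t₀ = y₀ ∧ y t₁ = y₁ ∧
    ∀ t ∈ Icc t₀ t₁, HasDerivWithinAt y (f t (y t)) (Icc t₀ t₁) t

section Integrator

variable {n : 𝓛 → ℕ} {r : OTree 𝓛 → ℕ} {m : ℕ} {c : Fin m → OTree 𝓛}

/-- The prolongation `π_{τ,i} : 𝒱_{τᵢ} → 𝒱_τ` belonging to the matrix `W = V_{τᵢ}⁰`. -/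
def prolong (i : Fin m)
    (W : Matrix (Fin (r (.node m c)) × ((j : {j // j ≠ i}) → Idx n (c j))) (Fin (r (c i))) ℝ)
    (Y : V n r (c i)) : V n r (.node m c) :=
  ten (γ := fun j => Idx n (c j)) i (W * mat₀ Y).transpose

/-- The restriction `π_{τ,i}† : 𝒱_τ → 𝒱_{τᵢ}` belonging to the matrix `W = V_{τᵢ}⁰`. -/
def restrict (i : Fin m)
    (W : Matrix (Fin (r (.node m c)) × ((j : {j // j ≠ i}) → Idx n (c j))) (Fin (r (c i))) ℝ)
    (Z : V n r (.node m c)) : V n r (c i) :=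
  ten₀ (mat (γ := fun j => Idx n (c j)) i Z * W).transpose

/-- The function `F_{τᵢ} = π_{τ,i}† ∘ F_τ ∘ π_{τ,i}`. -/
def subF (i : Fin m)
    (W : Matrix (Fin (r (.node m c)) × ((j : {j // j ≠ i}) → Idx n (c j))) (Fin (r (c i))) ℝ)
    (F : ℝ → V n r (.node m c) → V n r (.node m c)) : ℝ → V n r (c i) → V n r (c i) :=
  fun t Y => restrict i W (F t (prolong i W Y))

/-- The subflow `Φ_τ^{(i)}`; `sub G Y Y'` says that `Y'` is a result of the integrator
(for a leaf: of the exact flow) on the subtree `τᵢ` for the function `G` and initial data `Y`.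
Any orthogonal decompositions are allowed in place of the two QR decompositions. -/
def Phi (i : Fin m) (sub : (ℝ → V n r (c i) → V n r (c i)) → TTN n r (c i) → TTN n r (c i) → Prop)
    (F : ℝ → V n r (.node m c) → V n r (.node m c)) (t₀ t₁ : ℝ)
    (D₀ D₁ : TTN n r (.node m c)) : Prop :=
  (∀ j, j ≠ i → D₁.child j = D₀.child j) ∧
  ∃ (Q : Matrix (Fin (r (.node m c)) × ((j : {j // j ≠ i}) → Fin (r (c j)))) (Fin (r (c i))) ℝ)
    (S₀ S₁ S₂ : Matrix (Fin (r (c i))) (Fin (r (c i))) ℝ) (K : TTN n r (c i))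
    (G : ℝ → V n r (c i) → V n r (c i)),
    -- orthogonal decomposition `Matᵢ(C_τ)ᵀ = Q S₀ᵀ`
    (mat i D₀.core).transpose = Q * S₀.transpose ∧ Q.transpose * Q = 1 ∧
    -- the function on the subtree
    G = subF i (vMat (γ := fun j => Idx n (c j)) i Q fun j => (D₀.child j).basis) F ∧
    -- evolution on the subtree from the initial value `X_{τᵢ} ×₀ S₀ᵀ`
    sub G ((D₀.child i).mulTop S₀) K ∧
    -- orthogonal decomposition of the root factor of the result
    K = (D₁.child i).mulTop S₁ ∧ (D₁.child i).TopOrthonormal ∧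
    -- the differential equation for `S` with the negative sign
    Solves (fun t S => ten₀ (-((D₁.child i).basis.transpose *
        (mat₀ (G t ((D₁.child i).mulTop (mat₀ S)).tensor)).transpose)))
      t₀ t₁ (ten₀ S₁) (ten₀ S₂) ∧
    D₁.core = ten i (S₂ * Q.transpose)

/-- The subflow `Ψ_τ`. -/
def Psi (F : ℝ → V n r (.node m c) → V n r (.node m c)) (t₀ t₁ : ℝ)
    (D₀ D₁ : TTN n r (.node m c)) : Prop :=
  D₁.child = D₀.child ∧
  Solves (fun t C => tucker (γ := fun j => Fin (r (c j))) (κ := fun j => Idx n (c j))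
      (F t (TTN.node C D₀.child).tensor) fun j => (D₀.child j).basis.transpose)
    t₀ t₁ D₀.core D₁.core

/-- One step of the recursive tree tensor network integrator on `τ` for the function `F`
from `t₀` to `t₁`: the relation `Step τ F t₀ t₁ D₀ D₁` says that the integrator, started from the
network `D₀`, can return the network `D₁`. At a leaf the differential equation is solved. At
`τ = (τ₁, …, τₘ)` the step is `Ψ_τ ∘ Φ_τ^{(m)} ∘ ⋯ ∘ Φ_τ^{(1)}`. -/
def Step : (τ : OTree 𝓛) → (ℝ → V n r τ → V n r τ) → ℝ → ℝ → TTN n r τ → TTN n r τ → Prop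
  | .leaf _, F, t₀, t₁, D₀, D₁ => Solves F t₀ t₁ D₀.tensor D₁.tensor
  | .node m c, F, t₀, t₁, D₀, D₁ =>
      ∃ E : Fin (m + 1) → TTN n r (.node m c), E 0 = D₀ ∧
        (∀ i : Fin m,
          Phi i (fun G Y Y' => Step (c i) G t₀ t₁ Y Y') F t₀ t₁ (E i.castSucc) (E i.succ)) ∧
        Psi F t₀ t₁ (E (Fin.last m)) D₁

end Integrator

end TreeTN

end

open TreeTN

noncomputable section

namespace TreeTN

open Matrix Filter Topology
open scoped RealInnerProductSpace Kronecker

/-! ### Multilinear algebra -/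

section Algebra

/-! The proof compares one step with the exact increment `G t₁ - G t₀`, where `G' = g` and `g t = F
t (A t)`. During a short step all intermediate tensors stay within `cst τ * B * h` of the starting
value. There the Lipschitz condition makes `F t Y` differ from `g t` by at most some `η = O(h + e)`,
with `e` the current error, so `F` may be treated as nearly independent of `Y`. For such an `F` the
step telescopes. After the subflows `1, …, k` at a node, the accumulated increment is `ΔG` minus its
projection, in the modes `1, …, k`, onto the ranges of the new bases `U_j`. The final flow of the
connection tensor supplies precisely the projection in all modes, and the sum is `ΔG`.

One subflow contributes the difference of two consecutive projections, up to a remainder of the form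
`(1 - U Uᵀ) Matᵢ(ΔG) (1 - W Wᵀ)` (`tuckerV_sub_update`). Before this remainder is projected in the
other modes, it is normal to the manifold at the value reached by the subflow, so the near tangency
of `F` makes it of size `h (η + ε)`. Recursion over the tree gives `step_local_error`, and a
discrete Gronwall argument gives the theorem.

Intermediate tensors need not have full rank, so they lie only in the closure of the manifold, where
tangent projections are not available. Tangency is therefore used only in the form `⟪Z, F t Y⟫ ≤ ε *
‖Z‖` for pairs `(Y, Z)` with `Z` normal at `Y`. This inequality passes to limits of such pairs
(`localHyp_of_assumptions`). Two facts about limits carry the argument: prolongation from a subtree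
preserves them (`prolong_mem_closure_normalPairs`), so that the hypotheses are inherited by the
subtrees without loss, and the remainder above is the second component of one
(`mem_closure_normalPairs_of_mul_eq_zero`). Both come from perturbing a degenerate network to one of
full rank. Inverses of nearly singular matrices occur only in these qualitative limits, never in an
estimate, so no singular value enters the constants. -/

/-- The Kronecker product of a finite family of matrices. -/
def kron {ι : Type*} [Fintype ι] {γ κ : ι → Type*} (U : (j : ι) → Matrix (γ j) (κ j) ℝ) :
    Matrix ((j : ι) → γ j) ((j : ι) → κ j) ℝ :=
  Matrix.of fun p l => ∏ j, U j (p j) (l j)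

theorem kron_mul {ι : Type*} [Fintype ι] [DecidableEq ι] {γ κ μ : ι → Type*}
    [∀ j, Fintype (κ j)] (A : (j : ι) → Matrix (γ j) (κ j) ℝ) (B : (j : ι) → Matrix (κ j) (μ j) ℝ) :
    kron A * kron B = kron fun j => A j * B j := by
  ext p q
  simp only [kron, Matrix.mul_apply, Matrix.of_apply, ← Finset.prod_mul_distrib]
  rw [Finset.prod_univ_sum, Fintype.piFinset_univ]

theorem kron_one {ι : Type*} [Fintype ι] [DecidableEq ι] {γ : ι → Type*}
    [∀ j, DecidableEq (γ j)] : kron (fun j => (1 : Matrix (γ j) (γ j) ℝ)) = 1 := by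
  ext p q
  by_cases h : p = q
  · subst h; simp [kron]
  · obtain ⟨j, hj⟩ := Function.ne_iff.1 h
    rw [Matrix.one_apply_ne h, kron, Matrix.of_apply]
    exact Finset.prod_eq_zero (Finset.mem_univ j) (Matrix.one_apply_ne hj)

theorem kron_transpose {ι : Type*} [Fintype ι] {γ κ : ι → Type*}
    (U : (j : ι) → Matrix (γ j) (κ j) ℝ) : (kron U)ᵀ = kron fun j => (U j)ᵀ := by
  ext p q; simp [kron]

variable {α β : Type*}

@[simp] theorem mat₀_ten₀ (M : Matrix α β ℝ) : mat₀ (ten₀ M) = M := rfl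
@[simp] theorem ten₀_mat₀ (T : EuclideanSpace ℝ (α × β)) : ten₀ (mat₀ T) = T := rfl

theorem mat₀_injective : Function.Injective (mat₀ : EuclideanSpace ℝ (α × β) → Matrix α β ℝ) :=
  Function.LeftInverse.injective ten₀_mat₀

theorem mat₀_add (x y : EuclideanSpace ℝ (α × β)) : mat₀ (x + y) = mat₀ x + mat₀ y := rfl
theorem mat₀_smul (a : ℝ) (x : EuclideanSpace ℝ (α × β)) : mat₀ (a • x) = a • mat₀ x := rfl

variable {m : ℕ} {γ κ μ : Fin m → Type*}

@[simp] theorem mat_ten (i : Fin m) (M : Matrix (γ i) (α × ((j : {j // j ≠ i}) → γ j)) ℝ) :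
    mat i (ten i M) = M := by
  ext k ⟨a, q⟩
  simp only [mat, ten, Matrix.of_apply, Equiv.piSplitAt_symm_apply]
  have h : (fun j : {j // j ≠ i} =>
      if h : (j : Fin m) = i then h.symm ▸ k else q ⟨j, h⟩) = q := by
    funext j
    exact dif_neg j.2
  simp [h]

@[simp] theorem ten_mat (i : Fin m) (T : EuclideanSpace ℝ (α × ((j : Fin m) → γ j))) :
    ten i (mat i T) = T := by
  ext ⟨a, p⟩
  exact congrArg (fun q => T (a, q)) ((Equiv.piSplitAt i γ).symm_apply_apply p)

theorem mat_injective (i : Fin m) :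
    Function.Injective (mat i : EuclideanSpace ℝ (α × ((j : Fin m) → γ j)) → _) :=
  Function.LeftInverse.injective (ten_mat i)

theorem mat_add (i : Fin m) (x y : EuclideanSpace ℝ (α × ((j : Fin m) → γ j))) :
    mat i (x + y) = mat i x + mat i y := rfl
theorem mat_smul (i : Fin m) (a : ℝ) (x : EuclideanSpace ℝ (α × ((j : Fin m) → γ j))) :
    mat i (a • x) = a • mat i x := rfl

theorem mat₀_tucker [∀ j, Fintype (κ j)] (C : EuclideanSpace ℝ (α × ((j : Fin m) → κ j)))
    (U : (j : Fin m) → Matrix (γ j) (κ j) ℝ) : mat₀ (tucker C U) = mat₀ C * (kron U)ᵀ := by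
  ext a p
  simp [mat₀, tucker, kron, Matrix.mul_apply]

theorem tucker_tucker [∀ j, Fintype (κ j)] [∀ j, Fintype (γ j)]
    (C : EuclideanSpace ℝ (α × ((j : Fin m) → κ j)))
    (U : (j : Fin m) → Matrix (γ j) (κ j) ℝ) (B : (j : Fin m) → Matrix (μ j) (γ j) ℝ) :
    tucker (tucker C U) B = tucker C fun j => B j * U j := by
  apply mat₀_injective
  rw [mat₀_tucker, mat₀_tucker, mat₀_tucker, Matrix.mul_assoc, ← Matrix.transpose_mul, kron_mul]

theorem tucker_one [∀ j, Fintype (κ j)] [∀ j, DecidableEq (κ j)]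
    (C : EuclideanSpace ℝ (α × ((j : Fin m) → κ j))) :
    tucker C (fun j => (1 : Matrix (κ j) (κ j) ℝ)) = C := by
  apply mat₀_injective
  rw [mat₀_tucker, kron_one, Matrix.transpose_one, Matrix.mul_one]

theorem vMat_eq [Fintype α] [DecidableEq α] [∀ j, Fintype (κ j)] (i : Fin m)
    (Q : Matrix (α × ((j : {j // j ≠ i}) → κ j)) (κ i) ℝ) (U : (j : Fin m) → Matrix (γ j) (κ j) ℝ) :
    vMat i Q U = ((1 : Matrix α α ℝ) ⊗ₖ kron fun j : {j // j ≠ i} => U j) * Q := by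
  ext ⟨a, p⟩ b
  simp only [vMat, Matrix.of_apply, Matrix.mul_apply, Matrix.kroneckerMap_apply, kron,
    Fintype.sum_prod_type, Matrix.one_apply, ite_mul, one_mul, zero_mul]
  rw [Finset.sum_eq_single a]
  · simp [mul_comm]
  · intro b' _ h; simp [h.symm]
  · simp

theorem vMat_congr [∀ j, Fintype (κ j)] (i : Fin m)
    (Q : Matrix (α × ((j : {j // j ≠ i}) → κ j)) (κ i) ℝ) {U U' : (j : Fin m) → Matrix (γ j) (κ j) ℝ}
    (h : ∀ j, j ≠ i → U j = U' j) : vMat i Q U = vMat i Q U' := by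
  ext p b
  simp only [vMat, Matrix.of_apply]
  refine Finset.sum_congr rfl fun l _ => ?_
  congr 1
  exact Finset.prod_congr rfl fun j _ => by rw [h j j.2]

theorem vMat_orthonormal [Fintype α] [∀ j, Fintype (κ j)] [∀ j, DecidableEq (κ j)]
    [∀ j, Fintype (γ j)] (i : Fin m)
    {Q : Matrix (α × ((j : {j // j ≠ i}) → κ j)) (κ i) ℝ} {U : (j : Fin m) → Matrix (γ j) (κ j) ℝ}
    (hQ : Qᵀ * Q = 1) (hU : ∀ j, j ≠ i → (U j)ᵀ * U j = 1) :
    (vMat i Q U)ᵀ * vMat i Q U = 1 := by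
  classical
  rw [vMat_eq, Matrix.transpose_mul, Matrix.mul_assoc, ← Matrix.mul_assoc _ _ Q,
    ← Matrix.kroneckerMap_transpose, ← Matrix.mul_kronecker_mul, kron_transpose, kron_mul]
  have : (fun j : {j // j ≠ i} => (U j)ᵀ * U j) = fun j => 1 := funext fun j => hU j j.2
  rw [this, kron_one, Matrix.transpose_one, Matrix.mul_one, Matrix.one_kronecker_one,
    Matrix.one_mul, hQ]

/-- Collecting all modes other than `i` into one matrix shows that the `i`-th matricization factors
through the rank index `κ i`. This is the low-rank structure on which the normal-space computations
rest. -/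
theorem mat_tucker [∀ j, Fintype (κ j)] (i : Fin m)
    (C : EuclideanSpace ℝ (α × ((j : Fin m) → κ j))) (U : (j : Fin m) → Matrix (γ j) (κ j) ℝ) :
    mat i (tucker C U) = U i * (vMat i (mat i C)ᵀ U)ᵀ := by
  ext k ⟨a, p⟩
  simp only [mat, tucker, vMat, Matrix.of_apply, Matrix.mul_apply, Matrix.transpose_apply]
  rw [← (Equiv.piSplitAt i κ).symm.sum_comp, Fintype.sum_prod_type]
  refine Finset.sum_congr rfl fun b _ => ?_
  rw [Finset.mul_sum]
  refine Finset.sum_congr rfl fun l _ => ?_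
  rw [Fintype.prod_eq_mul_prod_subtype_ne _ i]
  have h1 : ∀ j : {j // j ≠ i}, (Equiv.piSplitAt i κ).symm (b, l) j = l j := by
    intro j; simp [Equiv.piSplitAt_symm_apply, j.2]
  have h2 : ∀ j : {j // j ≠ i}, (Equiv.piSplitAt i γ).symm (k, p) j = p j := by
    intro j; simp [Equiv.piSplitAt_symm_apply, j.2]
  have h3 : (Equiv.piSplitAt i κ).symm (b, l) i = b := by simp [Equiv.piSplitAt_symm_apply]
  have h4 : (Equiv.piSplitAt i γ).symm (k, p) i = k := by simp [Equiv.piSplitAt_symm_apply]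
  rw [h3, h4]
  simp only [h1, h2]
  ring

/-! ### Frobenius inner products, adjoints and contractions. -/

theorem inner_eq_trace_mat₀ [Fintype α] [Fintype β] (x y : EuclideanSpace ℝ (α × β)) :
    ⟪x, y⟫ = Matrix.trace ((mat₀ x)ᵀ * mat₀ y) := by
  simp only [PiLp.inner_apply, Matrix.trace, Matrix.diag, Matrix.mul_apply, mat₀, Matrix.of_apply,
    Matrix.transpose_apply, RCLike.inner_apply, conj_trivial]
  rw [Fintype.sum_prod_type, Finset.sum_comm]
  simp [mul_comm]

theorem inner_eq_trace_mat [Fintype α] [∀ j, Fintype (γ j)] (i : Fin m)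
    (x y : EuclideanSpace ℝ (α × ((j : Fin m) → γ j))) :
    ⟪x, y⟫ = Matrix.trace ((mat i x)ᵀ * mat i y) := by
  simp only [PiLp.inner_apply, Matrix.trace, Matrix.diag, Matrix.mul_apply, mat, Matrix.of_apply,
    Matrix.transpose_apply, RCLike.inner_apply, conj_trivial]
  rw [Fintype.sum_prod_type, Fintype.sum_prod_type]
  refine Finset.sum_congr rfl fun a _ => ?_
  rw [← (Equiv.piSplitAt i γ).symm.sum_comp, Fintype.sum_prod_type, Finset.sum_comm]
  simp [mul_comm]

/-- The Tucker product as a continuous linear map of the core. -/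
def tuckerL [Fintype α] [∀ j, Fintype (κ j)] [∀ j, Fintype (γ j)]
    (U : (j : Fin m) → Matrix (γ j) (κ j) ℝ) :
    EuclideanSpace ℝ (α × ((j : Fin m) → κ j)) →L[ℝ] EuclideanSpace ℝ (α × ((j : Fin m) → γ j)) :=
  LinearMap.toContinuousLinearMap
    { toFun := fun C => tucker C U
      map_add' := fun x y => mat₀_injective (by
        simp only [mat₀_tucker, mat₀_add, Matrix.add_mul])
      map_smul' := fun a x => mat₀_injective (by
        simp only [mat₀_tucker, mat₀_smul, Matrix.smul_mul, RingHom.id_apply]) }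

@[simp] theorem tuckerL_apply [Fintype α] [∀ j, Fintype (κ j)] [∀ j, Fintype (γ j)]
    (U : (j : Fin m) → Matrix (γ j) (κ j) ℝ) (C : EuclideanSpace ℝ (α × ((j : Fin m) → κ j))) :
    tuckerL U C = tucker C U := rfl

theorem inner_tucker [Fintype α] [∀ j, Fintype (κ j)] [∀ j, Fintype (γ j)]
    (U : (j : Fin m) → Matrix (γ j) (κ j) ℝ) (x : EuclideanSpace ℝ (α × ((j : Fin m) → κ j)))
    (y : EuclideanSpace ℝ (α × ((j : Fin m) → γ j))) :
    ⟪tucker x U, y⟫ = ⟪x, tucker y fun j => (U j)ᵀ⟫ := by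
  rw [inner_eq_trace_mat₀, inner_eq_trace_mat₀, mat₀_tucker, mat₀_tucker, Matrix.transpose_mul,
    Matrix.transpose_transpose, Matrix.trace_mul_comm, ← Matrix.mul_assoc,
    Matrix.trace_mul_comm, ← kron_transpose, Matrix.transpose_transpose]

/-- The map `Z ↦ Tenᵢ(M Matᵢ(Z) N)`. -/
def sandwichL [Fintype α] [∀ j, Fintype (γ j)] (i : Fin m) (M : Matrix (γ i) (γ i) ℝ)
    (N : Matrix (α × ((j : {j // j ≠ i}) → γ j)) (α × ((j : {j // j ≠ i}) → γ j)) ℝ) :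
    EuclideanSpace ℝ (α × ((j : Fin m) → γ j)) →L[ℝ] EuclideanSpace ℝ (α × ((j : Fin m) → γ j)) :=
  LinearMap.toContinuousLinearMap
    { toFun := fun Z => ten i (M * mat i Z * N)
      map_add' := fun x y => mat_injective i (by
        simp only [mat_add, mat_ten, Matrix.add_mul, Matrix.mul_add])
      map_smul' := fun a x => mat_injective i (by
        simp only [mat_smul, mat_ten, Matrix.smul_mul, Matrix.mul_smul, RingHom.id_apply]) }

@[simp] theorem mat_sandwichL [Fintype α] [∀ j, Fintype (γ j)] (i : Fin m)
    (M : Matrix (γ i) (γ i) ℝ)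
    (N : Matrix (α × ((j : {j // j ≠ i}) → γ j)) (α × ((j : {j // j ≠ i}) → γ j)) ℝ)
    (Z : EuclideanSpace ℝ (α × ((j : Fin m) → γ j))) :
    mat i (sandwichL i M N Z) = M * mat i Z * N := mat_ten i _

theorem inner_sandwichL [Fintype α] [∀ j, Fintype (γ j)] (i : Fin m) (M : Matrix (γ i) (γ i) ℝ)
    (N : Matrix (α × ((j : {j // j ≠ i}) → γ j)) (α × ((j : {j // j ≠ i}) → γ j)) ℝ)
    (x y : EuclideanSpace ℝ (α × ((j : Fin m) → γ j))) :
    ⟪sandwichL i M N x, y⟫ = ⟪x, sandwichL i Mᵀ Nᵀ y⟫ := by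
  rw [inner_eq_trace_mat i, inner_eq_trace_mat i, mat_sandwichL, mat_sandwichL,
    Matrix.transpose_mul, Matrix.transpose_mul, Matrix.trace_mul_comm, ← Matrix.mul_assoc,
    Matrix.trace_mul_comm]
  simp only [Matrix.mul_assoc]

theorem sandwichL_sandwichL [Fintype α] [∀ j, Fintype (γ j)] (i : Fin m)
    (M M' : Matrix (γ i) (γ i) ℝ)
    (N N' : Matrix (α × ((j : {j // j ≠ i}) → γ j)) (α × ((j : {j // j ≠ i}) → γ j)) ℝ)
    (Z : EuclideanSpace ℝ (α × ((j : Fin m) → γ j))) :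
    sandwichL i M N (sandwichL i M' N' Z) = sandwichL i (M * M') (N' * N) Z := by
  apply mat_injective i
  simp only [mat_sandwichL, Matrix.mul_assoc]

/-- Cauchy–Schwarz. The hypothesis holds when `x` is an orthogonal projection of `y`, and this is
how every contraction estimate below is obtained. -/
theorem norm_le_of_norm_sq_eq_inner {E : Type*} [NormedAddCommGroup E] [InnerProductSpace ℝ E]
    {x y : E} (h : ⟪x, x⟫ = ⟪x, y⟫) : ‖x‖ ≤ ‖y‖ := by
  have h1 := real_inner_le_norm x y
  rw [← h, real_inner_self_eq_norm_mul_norm] at h1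
  rcases (norm_nonneg x).eq_or_lt with h0 | h0
  · rw [← h0]; exact norm_nonneg y
  · exact le_of_mul_le_mul_left h1 h0

theorem norm_tucker_le [Fintype α] [∀ j, Fintype (γ j)]
    {A : (j : Fin m) → Matrix (γ j) (γ j) ℝ} (hA : ∀ j, (A j)ᵀ = A j) (hA' : ∀ j, A j * A j = A j)
    (x : EuclideanSpace ℝ (α × ((j : Fin m) → γ j))) : ‖tucker x A‖ ≤ ‖x‖ := by
  apply norm_le_of_norm_sq_eq_inner
  conv_rhs => rw [real_inner_comm, ← real_inner_comm, inner_tucker]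
  rw [inner_tucker, tucker_tucker]
  simp only [hA, hA']

theorem sandwichL_self_inner [Fintype α] [∀ j, Fintype (γ j)] (i : Fin m)
    {M : Matrix (γ i) (γ i) ℝ}
    {N : Matrix (α × ((j : {j // j ≠ i}) → γ j)) (α × ((j : {j // j ≠ i}) → γ j)) ℝ}
    (hM : Mᵀ = M) (hM' : M * M = M) (hN : Nᵀ = N) (hN' : N * N = N)
    (x : EuclideanSpace ℝ (α × ((j : Fin m) → γ j))) :
    ⟪sandwichL i M N x, sandwichL i M N x⟫ = ⟪sandwichL i M N x, x⟫ := by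
  rw [real_inner_comm, inner_sandwichL, hM, hN, real_inner_comm, sandwichL_sandwichL, hM', hN',
    real_inner_comm]

theorem norm_sandwichL_le [Fintype α] [∀ j, Fintype (γ j)] (i : Fin m)
    {M : Matrix (γ i) (γ i) ℝ}
    {N : Matrix (α × ((j : {j // j ≠ i}) → γ j)) (α × ((j : {j // j ≠ i}) → γ j)) ℝ}
    (hM : Mᵀ = M) (hM' : M * M = M) (hN : Nᵀ = N) (hN' : N * N = N)
    (x : EuclideanSpace ℝ (α × ((j : Fin m) → γ j))) : ‖sandwichL i M N x‖ ≤ ‖x‖ :=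
  norm_le_of_norm_sq_eq_inner (sandwichL_self_inner i hM hM' hN hN' x)

/-! ### Prolongation and restriction as adjoint maps. -/

/-- The prolongation `Y ↦ Tenᵢ((W Mat₀(Y))ᵀ)`. -/
def prolongL {β : Type*} [Fintype α] [Fintype β] [∀ j, Fintype (γ j)] (i : Fin m)
    (W : Matrix (α × ((j : {j // j ≠ i}) → γ j)) β ℝ) :
    EuclideanSpace ℝ (β × γ i) →L[ℝ] EuclideanSpace ℝ (α × ((j : Fin m) → γ j)) :=
  LinearMap.toContinuousLinearMap
    { toFun := fun Y => ten i (W * mat₀ Y)ᵀ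
      map_add' := fun x y => mat_injective i (by
        simp only [mat_add, mat₀_add, mat_ten, Matrix.mul_add, Matrix.transpose_add])
      map_smul' := fun a x => mat_injective i (by
        simp only [mat_smul, mat₀_smul, mat_ten, Matrix.mul_smul, Matrix.transpose_smul,
          RingHom.id_apply]) }

/-- The restriction `Z ↦ Ten₀((Matᵢ(Z) W)ᵀ)`. -/
def restrictL {β : Type*} [Fintype α] [Fintype β] [∀ j, Fintype (γ j)] (i : Fin m)
    (W : Matrix (α × ((j : {j // j ≠ i}) → γ j)) β ℝ) :
    EuclideanSpace ℝ (α × ((j : Fin m) → γ j)) →L[ℝ] EuclideanSpace ℝ (β × γ i) :=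
  LinearMap.toContinuousLinearMap
    { toFun := fun Z => ten₀ (mat i Z * W)ᵀ
      map_add' := fun x y => mat₀_injective (by
        simp only [mat_add, mat₀_add, mat₀_ten₀, Matrix.add_mul, Matrix.transpose_add])
      map_smul' := fun a x => mat₀_injective (by
        simp only [mat_smul, mat₀_smul, mat₀_ten₀, Matrix.smul_mul, Matrix.transpose_smul,
          RingHom.id_apply]) }

section

variable {β : Type*} [Fintype α] [Fintype β] [∀ j, Fintype (γ j)] (i : Fin m)
    (W : Matrix (α × ((j : {j // j ≠ i}) → γ j)) β ℝ)

@[simp] theorem mat_prolongL (Y : EuclideanSpace ℝ (β × γ i)) :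
    mat i (prolongL i W Y) = (mat₀ Y)ᵀ * Wᵀ := by
  rw [← Matrix.transpose_mul]; exact mat_ten i _

@[simp] theorem mat₀_restrictL (Z : EuclideanSpace ℝ (α × ((j : Fin m) → γ j))) :
    mat₀ (restrictL i W Z) = Wᵀ * (mat i Z)ᵀ := by
  rw [← Matrix.transpose_mul]; rfl

theorem inner_prolongL (Y : EuclideanSpace ℝ (β × γ i))
    (Z : EuclideanSpace ℝ (α × ((j : Fin m) → γ j))) :
    ⟪prolongL i W Y, Z⟫ = ⟪Y, restrictL i W Z⟫ := by
  rw [inner_eq_trace_mat i, inner_eq_trace_mat₀, mat_prolongL, mat₀_restrictL]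
  conv_rhs => rw [← Matrix.trace_transpose]
  simp only [Matrix.transpose_mul, Matrix.transpose_transpose]
  rw [Matrix.trace_mul_comm, ← Matrix.mul_assoc]

variable {W} [DecidableEq β]

theorem restrictL_prolongL (hW : Wᵀ * W = 1) (Y : EuclideanSpace ℝ (β × γ i)) :
    restrictL i W (prolongL i W Y) = Y := by
  apply mat₀_injective
  rw [mat₀_restrictL, mat_prolongL, Matrix.transpose_mul, Matrix.transpose_transpose,
    Matrix.transpose_transpose, ← Matrix.mul_assoc, hW, Matrix.one_mul]

theorem norm_prolongL (hW : Wᵀ * W = 1) (Y : EuclideanSpace ℝ (β × γ i)) :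
    ‖prolongL i W Y‖ = ‖Y‖ := by
  have : ⟪prolongL i W Y, prolongL i W Y⟫ = ⟪Y, Y⟫ := by
    rw [inner_prolongL, restrictL_prolongL i hW]
  rwa [real_inner_self_eq_norm_sq, real_inner_self_eq_norm_sq,
    sq_eq_sq₀ (norm_nonneg _) (norm_nonneg _)] at this

theorem norm_restrictL_le (hW : Wᵀ * W = 1) (Z : EuclideanSpace ℝ (α × ((j : Fin m) → γ j))) :
    ‖restrictL i W Z‖ ≤ ‖Z‖ := by
  have h : ⟪prolongL i W (restrictL i W Z), prolongL i W (restrictL i W Z)⟫ =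
      ⟪prolongL i W (restrictL i W Z), Z⟫ := by
    rw [inner_prolongL, inner_prolongL, restrictL_prolongL i hW]
  rw [← norm_prolongL i hW]
  exact norm_le_of_norm_sq_eq_inner h

end

theorem prolongL_eq_tucker [Fintype α] [∀ j, Fintype (γ j)] [∀ j, Fintype (κ j)] (i : Fin m)
    (Q : Matrix (α × ((j : {j // j ≠ i}) → κ j)) (κ i) ℝ)
    (U : (j : Fin m) → Matrix (γ j) (κ j) ℝ) (Y : EuclideanSpace ℝ (κ i × γ i)) :
    prolongL i (vMat i Q U) Y = tucker (ten i Qᵀ) (Function.update U i (mat₀ Y)ᵀ) := by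
  apply mat_injective i
  rw [mat_tucker, mat_prolongL, mat_ten, Function.update_self, Matrix.transpose_transpose,
    vMat_congr i Q fun j hj => Function.update_of_ne hj _ U]

/-- The matrix `S` sits on the edge between the core and its `i`-th branch and can be absorbed on
either side. This turns a network whose core is `Q` times `S` into a prolongation from the subtree.
-/
theorem tucker_ten_mul [Fintype α] [∀ j, Fintype (γ j)] [∀ j, Fintype (κ j)] (i : Fin m)
    (Q : Matrix (α × ((j : {j // j ≠ i}) → κ j)) (κ i) ℝ) (S : Matrix (κ i) (κ i) ℝ)
    (U : (j : Fin m) → Matrix (γ j) (κ j) ℝ) :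
    tucker (ten i (S * Qᵀ)) U = prolongL i (vMat i Q U) (ten₀ (U i * S)ᵀ) := by
  classical
  apply mat_injective i
  rw [mat_tucker, mat_prolongL, mat_ten, Matrix.transpose_mul, Matrix.transpose_transpose,
    vMat_eq, vMat_eq, mat₀_ten₀, Matrix.transpose_transpose, ← Matrix.mul_assoc,
    Matrix.transpose_mul, Matrix.transpose_transpose, Matrix.mul_assoc]

theorem ten_mul_eq_tucker [Fintype α] [∀ j, Fintype (κ j)] [∀ j, DecidableEq (κ j)] (i : Fin m)
    (Q : Matrix (α × ((j : {j // j ≠ i}) → κ j)) (κ i) ℝ) (S : Matrix (κ i) (κ i) ℝ) :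
    ten i (S * Qᵀ) = tucker (ten i Qᵀ) (Function.update (fun _ => 1) i S) := by
  have h := prolongL_eq_tucker i Q (fun j => (1 : Matrix (κ j) (κ j) ℝ)) (ten₀ Sᵀ)
  rw [mat₀_ten₀, Matrix.transpose_transpose] at h
  rw [← h, ← tucker_one (ten i (S * Qᵀ)), tucker_ten_mul, Matrix.one_mul]

theorem tucker_prolongL [Fintype α] [∀ j, Fintype (γ j)] [∀ j, DecidableEq (γ j)]
    [∀ j, Fintype (κ j)] (i : Fin m) (Q : Matrix (α × ((j : {j // j ≠ i}) → κ j)) (κ i) ℝ)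
    (U : (j : Fin m) → Matrix (γ j) (κ j) ℝ) {A : (j : Fin m) → Matrix (γ j) (γ j) ℝ}
    (hi : A i = 1) (hA : ∀ j, j ≠ i → A j * U j = U j) (Y : EuclideanSpace ℝ (κ i × γ i)) :
    tucker (prolongL i (vMat i Q U) Y) A = prolongL i (vMat i Q U) Y := by
  rw [prolongL_eq_tucker, tucker_tucker]
  congr 1
  funext j
  by_cases h : j = i
  · subst h; rw [hi, Matrix.one_mul]
  · rw [Function.update_of_ne h, hA j h]

theorem tucker_update [Fintype α] [DecidableEq α] [∀ j, Fintype (γ j)] [∀ j, DecidableEq (γ j)] (i : Fin m)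
    {A : (j : Fin m) → Matrix (γ j) (γ j) ℝ} (hi : A i = 1) (P : Matrix (γ i) (γ i) ℝ)
    (Z : EuclideanSpace ℝ (α × ((j : Fin m) → γ j))) :
    tucker (sandwichL i P 1 Z) A = tucker Z (Function.update A i P) := by
  have h : sandwichL i P 1 Z = tucker Z (Function.update (fun _ => 1) i P) := by
    apply mat_injective i
    rw [mat_sandwichL, Matrix.mul_one, mat_tucker, Function.update_self,
      vMat_congr i _ fun j hj => Function.update_of_ne hj _ _, vMat_eq, kron_one]
    simp
  rw [h, tucker_tucker]
  congr 1
  funext j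
  by_cases hj : j = i
  · subst hj; simp [hi]
  · simp [hj]

end Algebra

/-! ### Matrices of full rank -/

section FullRankMatrices

variable {a b : Type*} [Fintype a] [Fintype b]

theorem rank_eq_card_iff_exists_left_inv [DecidableEq b] {M : Matrix a b ℝ} :
    M.rank = Fintype.card b ↔ ∃ N : Matrix b a ℝ, N * M = 1 := by
  constructor
  · intro h
    rw [Matrix.rank, LinearMap.range_eq_map] at h
    have hk : LinearMap.ker M.mulVecLin = ⊥ := by
      have h2 := M.mulVecLin.finrank_range_add_finrank_ker
      rw [LinearMap.range_eq_map, h, Module.finrank_fintype_fun_eq_card] at h2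
      exact Submodule.finrank_eq_zero.1 (by omega)
    obtain ⟨g, hg⟩ := LinearMap.exists_leftInverse_of_injective _ hk
    classical
    refine ⟨LinearMap.toMatrix' g, ?_⟩
    have := congrArg LinearMap.toMatrix' hg
    rwa [LinearMap.toMatrix'_comp, LinearMap.toMatrix'_id, ← Matrix.toLin'_apply',
      LinearMap.toMatrix'_toLin'] at this
  · rintro ⟨N, h⟩
    refine le_antisymm (Matrix.rank_le_card_width M) ?_
    calc Fintype.card b = (1 : Matrix b b ℝ).rank := Matrix.rank_one.symm
      _ = (N * M).rank := by rw [h]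
      _ ≤ M.rank := Matrix.rank_mul_le_right N M

theorem rank_eq_card_iff_exists_right_inv [DecidableEq a] {M : Matrix a b ℝ} :
    M.rank = Fintype.card a ↔ ∃ N : Matrix b a ℝ, M * N = 1 := by
  rw [← Matrix.rank_transpose, rank_eq_card_iff_exists_left_inv]
  constructor
  · rintro ⟨N, h⟩
    exact ⟨Nᵀ, by rw [← Matrix.transpose_transpose M, ← Matrix.transpose_mul, h,
      Matrix.transpose_one]⟩
  · rintro ⟨N, h⟩
    exact ⟨Nᵀ, by rw [← Matrix.transpose_mul, h, Matrix.transpose_one]⟩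

theorem rank_eq_iff_exists_left_inv {k : ℕ} {M : Matrix a (Fin k) ℝ} :
    M.rank = k ↔ ∃ N : Matrix (Fin k) a ℝ, N * M = 1 := by
  rw [← rank_eq_card_iff_exists_left_inv, Fintype.card_fin]

theorem rank_eq_iff_exists_right_inv {k : ℕ} {M : Matrix (Fin k) b ℝ} :
    M.rank = k ↔ ∃ N : Matrix b (Fin k) ℝ, M * N = 1 := by
  rw [← rank_eq_card_iff_exists_right_inv, Fintype.card_fin]

/-- The left inverse `(MᵀM)⁻¹Mᵀ` of a matrix with linearly independent columns. -/
def linv [DecidableEq b] (M : Matrix a b ℝ) : Matrix b a ℝ := (Mᵀ * M)⁻¹ * Mᵀ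

theorem tendsto_inv_of_det_ne_zero {X : Type*} {l : Filter X} [DecidableEq b]
    {f : X → Matrix b b ℝ} {M : Matrix b b ℝ} (hM : M.det ≠ 0) (hf : Tendsto f l (𝓝 M)) :
    Tendsto (fun x => (f x)⁻¹) l (𝓝 M⁻¹) := by
  have h : ContinuousAt Ring.inverse M.det := by
    rw [Ring.inverse_eq_inv']
    exact continuousAt_inv₀ hM
  exact (continuousAt_matrix_inv M h).tendsto.comp hf

theorem eventually_det_ne_zero {X : Type*} {l : Filter X} [DecidableEq b]
    {f : X → Matrix b b ℝ} {M : Matrix b b ℝ} (hM : M.det ≠ 0) (hf : Tendsto f l (𝓝 M)) :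
    ∀ᶠ x in l, (f x).det ≠ 0 :=
  ((continuous_id.matrix_det.tendsto M).comp hf).eventually_ne hM

omit [Fintype a] in
theorem tendsto_matrix_mul {X : Type*} {l : Filter X} {c : Type*} {f : X → Matrix a b ℝ}
    {g : X → Matrix b c ℝ} {M : Matrix a b ℝ} {N : Matrix b c ℝ} (hf : Tendsto f l (𝓝 M))
    (hg : Tendsto g l (𝓝 N)) : Tendsto (fun x => f x * g x) l (𝓝 (M * N)) := by
  have h : Continuous fun p : Matrix a b ℝ × Matrix b c ℝ => p.1 * p.2 :=
    continuous_fst.matrix_mul continuous_snd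
  exact (h.tendsto (M, N)).comp (hf.prodMk_nhds hg)

omit [Fintype a] [Fintype b] in
theorem tendsto_transpose {X : Type*} {l : Filter X} {f : X → Matrix a b ℝ}
    {M : Matrix a b ℝ} (hf : Tendsto f l (𝓝 M)) : Tendsto (fun x => (f x)ᵀ) l (𝓝 Mᵀ) :=
  ((continuous_id.matrix_transpose).tendsto M).comp hf

theorem tendsto_linv {X : Type*} {l : Filter X} [DecidableEq b]
    {f : X → Matrix a b ℝ} {M : Matrix a b ℝ} (hM : Mᵀ * M = 1) (hf : Tendsto f l (𝓝 M)) :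
    Tendsto (fun x => linv (f x)) l (𝓝 Mᵀ) := by
  have h : Tendsto (fun x => (f x)ᵀ * f x) l (𝓝 1) := by
    rw [← hM]; exact tendsto_matrix_mul (tendsto_transpose hf) hf
  have h1 := tendsto_matrix_mul (tendsto_inv_of_det_ne_zero (by simp) h) (tendsto_transpose hf)
  rwa [inv_one, Matrix.one_mul] at h1

theorem eventually_linv_mul {X : Type*} {l : Filter X} [DecidableEq b]
    {f : X → Matrix a b ℝ} {M : Matrix a b ℝ} (hM : Mᵀ * M = 1) (hf : Tendsto f l (𝓝 M)) :
    ∀ᶠ x in l, linv (f x) * f x = 1 := by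
  have h : Tendsto (fun x => (f x)ᵀ * f x) l (𝓝 1) := by
    rw [← hM]; exact tendsto_matrix_mul (tendsto_transpose hf) hf
  filter_upwards [eventually_det_ne_zero (by simp) h] with x hx
  rw [linv, Matrix.mul_assoc, Matrix.nonsing_inv_mul _ (isUnit_iff_ne_zero.2 hx)]

/-- Full row rank is an open condition: a right inverse `N` of the limit keeps `f x * N` close to
`1`, hence invertible. -/
theorem eventually_rank_eq_of_tendsto {X : Type*} {l : Filter X} [DecidableEq a]
    {f : X → Matrix a b ℝ} {M : Matrix a b ℝ} (hM : M.rank = Fintype.card a)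
    (hf : Tendsto f l (𝓝 M)) : ∀ᶠ x in l, (f x).rank = Fintype.card a := by
  obtain ⟨N, hN⟩ := rank_eq_card_iff_exists_right_inv.1 hM
  have h : Tendsto (fun x => f x * N) l (𝓝 1) := by
    rw [← hN]; exact tendsto_matrix_mul hf tendsto_const_nhds
  filter_upwards [eventually_det_ne_zero (by simp) h] with x hx
  exact rank_eq_card_iff_exists_right_inv.2 ⟨N * (f x * N)⁻¹, by
    rw [← Matrix.mul_assoc, Matrix.mul_nonsing_inv _ (isUnit_iff_ne_zero.2 hx)]⟩

/-- The determinant is the characteristic polynomial of `-M` at `s`, which has finitely many roots.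
Zero may be one of them, so the neighbourhood is punctured. -/
theorem eventually_det_add_smul_ne_zero [DecidableEq b] (M : Matrix b b ℝ) :
    ∀ᶠ s : ℝ in 𝓝[≠] 0, (M + s • (1 : Matrix b b ℝ)).det ≠ 0 := by
  have h : {s : ℝ | (-M).charpoly.IsRoot s}.Finite :=
    Polynomial.finite_setOfPred_isRoot (Matrix.charpoly_monic _).ne_zero
  filter_upwards [nhdsNE_le_cofinite (0 : ℝ) h.compl_mem_cofinite] with s hs
  intro h0
  apply hs
  rw [mem_ofPred_eq, Polynomial.IsRoot, Matrix.eval_charpoly, ← h0]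
  congr 1
  rw [sub_neg_eq_add, add_comm, Matrix.scalar_apply, Matrix.smul_one_eq_diagonal]

/-- A right inverse `R` of `N` reduces the claim to the determinant of `M * R + s • 1`. Here `M` is
arbitrary: any small multiple of a full-rank direction repairs its rank. -/
theorem eventually_rank_add_smul [DecidableEq a] (M : Matrix a b ℝ) {N : Matrix a b ℝ}
    (hN : N.rank = Fintype.card a) :
    ∀ᶠ s : ℝ in 𝓝[≠] 0, (M + s • N).rank = Fintype.card a := by
  obtain ⟨R, hR⟩ := rank_eq_card_iff_exists_right_inv.1 hN
  filter_upwards [eventually_det_add_smul_ne_zero (M * R)] with s hs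
  refine rank_eq_card_iff_exists_right_inv.2 ⟨R * ((M + s • N) * R)⁻¹, ?_⟩
  have h : (M + s • N) * R = M * R + s • 1 := by rw [Matrix.add_mul, Matrix.smul_mul, hR]
  rw [← Matrix.mul_assoc, Matrix.mul_nonsing_inv]
  rw [h]; exact isUnit_iff_ne_zero.2 hs

open scoped MatrixOrder in
/-- Orthonormalization of the columns of a matrix of full column rank. -/
theorem exists_orthonormalization [DecidableEq b] {M : Matrix a b ℝ} {N : Matrix b a ℝ}
    (h : N * M = 1) :
    ∃ S S' : Matrix b b ℝ, S * S' = 1 ∧ S' * S = 1 ∧ (M * S)ᵀ * (M * S) = 1 := by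
  have hp : (Mᵀ * M).PosSemidef := by
    have := Matrix.posSemidef_conjTranspose_mul_self M
    rwa [Matrix.conjTranspose_eq_transpose_of_trivial] at this
  have hR : CFC.sqrt (Mᵀ * M) * CFC.sqrt (Mᵀ * M) = Mᵀ * M :=
    CFC.sqrt_mul_sqrt_self _ (Matrix.nonneg_iff_posSemidef.2 hp)
  have hRT : (CFC.sqrt (Mᵀ * M))ᵀ = CFC.sqrt (Mᵀ * M) := by
    have := (Matrix.nonneg_iff_posSemidef.1 (CFC.sqrt_nonneg (Mᵀ * M))).isHermitian
    rwa [Matrix.IsHermitian, Matrix.conjTranspose_eq_transpose_of_trivial] at this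
  generalize CFC.sqrt (Mᵀ * M) = R at hR hRT
  have hdet : IsUnit R.det := by
    have h1 : (Mᵀ * M).rank = Fintype.card b := by
      rw [Matrix.rank_transpose_mul_self]
      exact rank_eq_card_iff_exists_left_inv.2 ⟨N, h⟩
    obtain ⟨K, hK⟩ := rank_eq_card_iff_exists_left_inv.1 h1
    rw [← hR, ← Matrix.mul_assoc] at hK
    exact Matrix.isUnit_det_of_left_inverse hK
  -- Polar decomposition: `M R⁻¹` with `R` the square root of `Mᵀ M`.
  refine ⟨R⁻¹, R, Matrix.nonsing_inv_mul _ hdet, Matrix.mul_nonsing_inv _ hdet, ?_⟩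
  rw [Matrix.transpose_mul, Matrix.mul_assoc, ← Matrix.mul_assoc _ M, ← hR,
    Matrix.transpose_nonsing_inv, hRT, Matrix.mul_assoc, Matrix.mul_nonsing_inv _ hdet,
    Matrix.mul_one, Matrix.nonsing_inv_mul _ hdet]

end FullRankMatrices

/-! ### Networks -/

section Networks

variable {𝓛 : Type*} {n : 𝓛 → ℕ} {r : OTree 𝓛 → ℕ}

instance Idx.instDecidableEq (n : 𝓛 → ℕ) : (τ : OTree 𝓛) → DecidableEq (Idx n τ)
  | .leaf l => inferInstanceAs (DecidableEq (Fin (n l)))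
  | .node m c =>
    haveI : ∀ i, DecidableEq (Idx n (c i)) := fun i => Idx.instDecidableEq n (c i)
    inferInstanceAs (DecidableEq ((i : Fin m) → Idx n (c i)))

namespace TTN

@[simp] theorem mat₀_tensor {τ : OTree 𝓛} (D : TTN n r τ) : mat₀ D.tensor = D.basisᵀ := rfl

theorem basis_mulTop {τ : OTree 𝓛} (D : TTN n r τ) (S : Matrix (Fin (r τ)) (Fin (r τ)) ℝ) :
    (D.mulTop S).basis = D.basis * S := by
  cases D with
  | leaf U => rfl
  | @node m c C D =>
    change (mat₀ (tucker (ten₀ (Sᵀ * mat₀ C)) fun i => (D i).basis))ᵀ =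
      (mat₀ (tucker C fun i => (D i).basis))ᵀ * S
    rw [mat₀_tucker, mat₀_tucker, mat₀_ten₀, Matrix.mul_assoc, Matrix.transpose_mul Sᵀ,
      Matrix.transpose_transpose]

theorem tensor_mulTop {τ : OTree 𝓛} (D : TTN n r τ) (S : Matrix (Fin (r τ)) (Fin (r τ)) ℝ) :
    (D.mulTop S).tensor = ten₀ (D.basis * S)ᵀ := by rw [tensor, basis_mulTop]

theorem orthonormal_mulTop {τ : OTree 𝓛} {D : TTN n r τ} {S : Matrix (Fin (r τ)) (Fin (r τ)) ℝ} :
    (D.mulTop S).Orthonormal ↔ D.Orthonormal := by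
  cases D <;> rfl

theorem eta {m : ℕ} {c : Fin m → OTree 𝓛} (D : TTN n r (.node m c)) :
    TTN.node D.core D.child = D := by cases D; rfl

theorem tensor_node {m : ℕ} {c : Fin m → OTree 𝓛} (C : Core r c) (D : (i : Fin m) → TTN n r (c i)) :
    (TTN.node C D).tensor = tucker (γ := fun j => Idx n (c j)) C fun i => (D i).basis := rfl

theorem basis_orthonormal {τ : OTree 𝓛} {D : TTN n r τ} (h : D.Orthonormal)
    (h' : D.TopOrthonormal) : D.basisᵀ * D.basis = 1 := by
  cases D with
  | leaf U => exact h'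
  | @node m c C D =>
    change (mat₀ (tucker C fun i => (D i).basis))ᵀᵀ * (mat₀ (tucker C fun i => (D i).basis))ᵀ = 1
    rw [mat₀_tucker, Matrix.transpose_transpose, Matrix.transpose_mul, Matrix.transpose_transpose,
      Matrix.mul_assoc, ← Matrix.mul_assoc _ (kron _), kron_transpose, kron_mul]
    have : (fun j => (D j).basisᵀ * (D j).basis) = fun j => 1 := funext fun j => (h j).1
    rw [this, kron_one, Matrix.one_mul]
    exact h'

/-- The network at the node whose `i`-th branch is replaced, as a prolongation. -/
theorem tensor_node_update_mulTop {m : ℕ} {c : Fin m → OTree 𝓛} (i : Fin m)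
    (Q : Matrix (Fin (r (.node m c)) × ((j : {j // j ≠ i}) → Fin (r (c j)))) (Fin (r (c i))) ℝ)
    (S : Matrix (Fin (r (c i))) (Fin (r (c i))) ℝ) (D : (j : Fin m) → TTN n r (c j)) :
    (TTN.node (ten (γ := fun j => Fin (r (c j))) i (S * Qᵀ)) D).tensor =
      prolong i (vMat (γ := fun j => Idx n (c j)) i Q fun j => (D j).basis)
        ((D i).mulTop S).tensor := by
  rw [tensor_mulTop, tensor_node]
  exact tucker_ten_mul (γ := fun j => Idx n (c j)) i Q S fun j => (D j).basis

theorem tensor_node_update {m : ℕ} {c : Fin m → OTree 𝓛} (i : Fin m)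
    (Q : Matrix (Fin (r (.node m c)) × ((j : {j // j ≠ i}) → Fin (r (c j)))) (Fin (r (c i))) ℝ)
    (D : (j : Fin m) → TTN n r (c j)) :
    (TTN.node (ten (γ := fun j => Fin (r (c j))) i Qᵀ) D).tensor =
      prolong i (vMat (γ := fun j => Idx n (c j)) i Q fun j => (D j).basis) (D i).tensor := by
  have h := tensor_node_update_mulTop i Q 1 D
  rwa [Matrix.one_mul, tensor_mulTop, Matrix.mul_one] at h

end TTN

/-! ### Full multilinear rank and its invariance. -/

/-- The core has full multilinear rank. -/
def FullMultirank {ρ₀ m : ℕ} {ρ : Fin m → ℕ}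
    (C : EuclideanSpace ℝ (Fin ρ₀ × ((i : Fin m) → Fin (ρ i)))) : Prop :=
  (mat₀ C).rank = ρ₀ ∧ ∀ i, (mat (γ := fun j => Fin (ρ j)) i C).rank = ρ i

theorem FullMultirank.eventually_add_smul {ρ₀ m : ℕ} {ρ : Fin m → ℕ}
    (C : EuclideanSpace ℝ (Fin ρ₀ × ((i : Fin m) → Fin (ρ i))))
    {C' : EuclideanSpace ℝ (Fin ρ₀ × ((i : Fin m) → Fin (ρ i)))} (h : FullMultirank C') :
    ∀ᶠ s : ℝ in 𝓝[≠] 0, FullMultirank (C + s • C') := by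
  have h1 := eventually_rank_add_smul (mat₀ C) (N := mat₀ C') (by simpa using h.1)
  have h2 : ∀ i, ∀ᶠ s : ℝ in 𝓝[≠] 0, _ := fun i =>
    eventually_rank_add_smul (mat (γ := fun j => Fin (ρ j)) i C)
      (N := mat (γ := fun j => Fin (ρ j)) i C') (by simpa using h.2 i)
  filter_upwards [h1, eventually_all.2 h2] with s hs hs'
  rw [Fintype.card_fin] at hs
  exact ⟨hs, fun i => (hs' i).trans (Fintype.card_fin _)⟩

theorem exists_right_inv_mat₀_tucker {α : Type*} {m : ℕ} {γ κ : Fin m → Type*}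
    [Fintype α] [DecidableEq α] [∀ j, Fintype (κ j)] [∀ j, DecidableEq (κ j)] [∀ j, Fintype (γ j)]
    {C : EuclideanSpace ℝ (α × ((j : Fin m) → κ j))} {U : (j : Fin m) → Matrix (γ j) (κ j) ℝ}
    (hC : ∃ N : Matrix ((j : Fin m) → κ j) α ℝ, mat₀ C * N = 1)
    (hU : ∀ j, ∃ N : Matrix (κ j) (γ j) ℝ, N * U j = 1) :
    ∃ N : Matrix ((j : Fin m) → γ j) α ℝ, mat₀ (tucker C U) * N = 1 := by
  obtain ⟨N, hN⟩ := hC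
  choose L hL using hU
  refine ⟨(kron L)ᵀ * N, ?_⟩
  rw [mat₀_tucker, Matrix.mul_assoc, ← Matrix.mul_assoc _ _ N, ← Matrix.transpose_mul, kron_mul]
  simp only [hL]
  rw [kron_one, Matrix.transpose_one, Matrix.one_mul, hN]

theorem FullMultirank.tucker {ρ₀ m : ℕ} {ρ : Fin m → ℕ}
    {C : EuclideanSpace ℝ (Fin ρ₀ × ((i : Fin m) → Fin (ρ i)))} (h : FullMultirank C)
    {S : (j : Fin m) → Matrix (Fin (ρ j)) (Fin (ρ j)) ℝ} 
    (hS : ∀ j, ∃ N : Matrix (Fin (ρ j)) (Fin (ρ j)) ℝ, N * S j = 1) :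
    FullMultirank (tucker (γ := fun j => Fin (ρ j)) C S) := by
  refine ⟨rank_eq_iff_exists_right_inv.2 (exists_right_inv_mat₀_tucker (γ := fun j => Fin (ρ j))
    (rank_eq_iff_exists_right_inv.1 h.1) hS), fun i => ?_⟩
  · obtain ⟨N, hN⟩ := rank_eq_iff_exists_right_inv.1 (h.2 i)
    choose L hL using hS
    apply rank_eq_iff_exists_right_inv.2
    refine ⟨((1 : Matrix (Fin ρ₀) (Fin ρ₀) ℝ) ⊗ₖ kron fun j : {j // j ≠ i} => L j)ᵀ * N * L i, ?_⟩
    rw [mat_tucker, vMat_eq, Matrix.transpose_mul, Matrix.transpose_transpose]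
    have hk : ((1 : Matrix (Fin ρ₀) (Fin ρ₀) ℝ) ⊗ₖ kron fun j : {j // j ≠ i} => S j)ᵀ *
        ((1 : Matrix (Fin ρ₀) (Fin ρ₀) ℝ) ⊗ₖ kron fun j : {j // j ≠ i} => L j)ᵀ = 1 := by
      rw [← Matrix.transpose_mul, ← Matrix.mul_kronecker_mul, kron_mul, Matrix.one_mul]
      simp only [hL]
      rw [kron_one, Matrix.one_kronecker_one, Matrix.transpose_one]
    calc _ = S i * (mat (γ := fun j => Fin (ρ j)) i C *
          ((((1 : Matrix (Fin ρ₀) (Fin ρ₀) ℝ) ⊗ₖ kron fun j : {j // j ≠ i} => S j)ᵀ *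
        ((1 : Matrix (Fin ρ₀) (Fin ρ₀) ℝ) ⊗ₖ kron fun j : {j // j ≠ i} => L j)ᵀ) * N)) * L i := by
          simp only [Matrix.mul_assoc]
      _ = 1 := by
          rw [hk, Matrix.one_mul, hN, Matrix.mul_one]
          exact mul_eq_one_comm.1 (hL i)

/-- A change of basis in mode `0` acts on the columns of the `i`-th matricization through `X ⊗ 1`,
so an invertible one leaves all multilinear ranks unchanged. -/
theorem mat_ten₀_mul {α : Type*} [Fintype α] {m : ℕ} {γ : Fin m → Type*}
    [∀ j, Fintype (γ j)] [∀ j, DecidableEq (γ j)] (i : Fin m) (X : Matrix α α ℝ)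
    (C : EuclideanSpace ℝ (α × ((j : Fin m) → γ j))) :
    mat i (ten₀ (X * mat₀ C)) =
      mat i C * (X ⊗ₖ (1 : Matrix ((j : {j // j ≠ i}) → γ j) ((j : {j // j ≠ i}) → γ j) ℝ))ᵀ := by
  ext k ⟨x, p⟩
  simp only [Matrix.mul_apply, Fintype.sum_prod_type, Matrix.transpose_apply,
    Matrix.kroneckerMap_apply, Matrix.one_apply, mul_ite, mul_one, mul_zero, Finset.sum_ite_eq,
    Finset.mem_univ, if_true]
  exact Finset.sum_congr rfl fun _ _ => mul_comm _ _

theorem FullMultirank.ten₀_mul {ρ₀ m : ℕ} {ρ : Fin m → ℕ}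
    {C : EuclideanSpace ℝ (Fin ρ₀ × ((i : Fin m) → Fin (ρ i)))} (h : FullMultirank C)
    {S S' : Matrix (Fin ρ₀) (Fin ρ₀) ℝ} (hS : S' * S = 1) :
    FullMultirank (ten₀ (Sᵀ * mat₀ C)) := by
  have hS' : S * S' = 1 := mul_eq_one_comm.1 hS
  refine ⟨?_, fun i => ?_⟩
  · obtain ⟨N, hN⟩ := rank_eq_iff_exists_right_inv.1 h.1
    refine rank_eq_iff_exists_right_inv.2 ⟨N * S'ᵀ, ?_⟩
    rw [mat₀_ten₀, Matrix.mul_assoc, ← Matrix.mul_assoc _ N, hN, Matrix.one_mul,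
      ← Matrix.transpose_mul, hS, Matrix.transpose_one]
  · obtain ⟨N, hN⟩ := rank_eq_iff_exists_right_inv.1 (h.2 i)
    refine rank_eq_iff_exists_right_inv.2
      ⟨(S'ᵀ ⊗ₖ (1 : Matrix ((j : {j // j ≠ i}) → Fin (ρ j)) _ ℝ))ᵀ * N, ?_⟩
    rw [mat_ten₀_mul, Matrix.mul_assoc, ← Matrix.mul_assoc _ _ N, ← Matrix.transpose_mul,
      ← Matrix.mul_kronecker_mul, ← Matrix.transpose_mul, hS', Matrix.one_mul,
      Matrix.transpose_one, Matrix.one_kronecker_one, Matrix.transpose_one, Matrix.one_mul, hN]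

namespace TTN

theorem fullRank_node {m : ℕ} {c : Fin m → OTree 𝓛} {C : Core r c}
    {D : (i : Fin m) → TTN n r (c i)} :
    (TTN.node C D).FullRank ↔ FullMultirank C ∧ ∀ i, (D i).FullRank := by
  rw [FullRank, FullMultirank, and_assoc]

theorem FullRank.exists_left_inv_basis {τ : OTree 𝓛} {D : TTN n r τ} (h : D.FullRank) :
    ∃ N : Matrix (Fin (r τ)) (Idx n τ) ℝ, N * D.basis = 1 := by
  induction D with
  | leaf U => exact rank_eq_iff_exists_left_inv.1 h
  | @node m c C D ih =>
    rw [fullRank_node] at h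
    obtain ⟨N, hN⟩ := exists_right_inv_mat₀_tucker (γ := fun j => Idx n (c j))
      (U := fun i => (D i).basis)
      (rank_eq_iff_exists_right_inv.1 h.1.1) fun j => ih j (h.2 j)
    refine ⟨Nᵀ, ?_⟩
    change Nᵀ * (mat₀ (tucker C fun i => (D i).basis))ᵀ = 1
    rw [← Matrix.transpose_mul, hN, Matrix.transpose_one]

theorem FullRank.mulTop {τ : OTree 𝓛} {D : TTN n r τ} (h : D.FullRank)
    {S S' : Matrix (Fin (r τ)) (Fin (r τ)) ℝ} (hS : S' * S = 1) : (D.mulTop S).FullRank := by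
  cases D with
  | leaf U =>
    obtain ⟨N, hN⟩ := rank_eq_iff_exists_left_inv.1 (show U.rank = _ from h)
    refine rank_eq_iff_exists_left_inv.2 ⟨S' * N, ?_⟩
    rw [Matrix.mul_assoc, ← Matrix.mul_assoc N, hN, Matrix.one_mul, hS]
  | @node m c C D =>
    rw [fullRank_node] at h
    exact fullRank_node.2 ⟨FullMultirank.ten₀_mul h.1 hS, h.2⟩

/-- Every tensor with a network of full rank has an orthonormal network of full rank. -/
theorem FullRank.tensor_mem_manifold {τ : OTree 𝓛} {D : TTN n r τ} (h : D.FullRank) :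
    D.tensor ∈ manifold n r τ := by
  induction D with
  | leaf U => exact ⟨.leaf U, h, trivial, rfl⟩
  | @node m c C D ih =>
    rw [fullRank_node] at h
    -- Each branch is replaced by one with orthonormal basis, and the inverse change of basis `S'`
    -- is moved into the parent core. Since `S'` is invertible, the core keeps its full multilinear
    -- rank.
    have key : ∀ i, ∃ (D' : TTN n r (c i)) (S S' : Matrix (Fin (r (c i))) (Fin (r (c i))) ℝ),
        D'.FullRank ∧ D'.Orthonormal ∧ D'.basisᵀ * D'.basis = 1 ∧ S * S' = 1 ∧
          (D i).basis = D'.basis * S' := by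
      intro i
      obtain ⟨D', h1, h2, h3⟩ := ih i (h.2 i)
      have h4 : D'.basis = (D i).basis := by
        have := congrArg (fun x => (mat₀ x)ᵀ) h3
        simpa using this
      obtain ⟨N, hN⟩ := h1.exists_left_inv_basis
      obtain ⟨S, S', hS, hS', hO⟩ := exists_orthonormalization hN
      refine ⟨D'.mulTop S, S, S', h1.mulTop hS', orthonormal_mulTop.2 h2, ?_, hS, ?_⟩
      · rw [basis_mulTop]; exact hO
      · rw [basis_mulTop, Matrix.mul_assoc, hS, Matrix.mul_one, h4]
    choose D' S S' h1 h2 h3 h4 h5 using key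
    refine ⟨.node (tucker (γ := fun j => Fin (r (c j))) C S') D',
      fullRank_node.2 ⟨FullMultirank.tucker h.1 fun j => ⟨S j, h4 j⟩, h1⟩, fun i => ⟨h3 i, h2 i⟩, ?_⟩
    rw [tensor_node, tensor_node]
    simp only [h5]
    exact tucker_tucker (κ := fun j => Fin (r (c j))) C S' fun j => (D' j).basis

/-! ### Perturbing arbitrary networks to full rank. -/

/-- The network `D + s E` (factor by factor). -/
def pert : {τ : OTree 𝓛} → TTN n r τ → TTN n r τ → ℝ → TTN n r τ
  | _, .leaf U, .leaf U', s => .leaf (U + s • U')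
  | _, .node C D, .node C' D', s => .node (C + s • C') fun i => pert (D i) (D' i) s

theorem FullRank.eventually_pert {τ : OTree 𝓛} (D : TTN n r τ) {E : TTN n r τ} (h : E.FullRank) :
    ∀ᶠ s : ℝ in 𝓝[≠] 0, (pert D E s).FullRank := by
  induction D with
  | leaf U =>
    cases E with
    | leaf U' =>
      have := eventually_rank_add_smul Uᵀ (N := U'ᵀ) (by
        rw [Matrix.rank_transpose, Fintype.card_fin]; exact h)
      filter_upwards [this] with s hs
      rwa [← Matrix.transpose_smul, ← Matrix.transpose_add, Matrix.rank_transpose,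
        Fintype.card_fin] at hs
  | @node m c C D ih =>
    cases E with
    | node C' D' =>
      rw [fullRank_node] at h
      filter_upwards [h.1.eventually_add_smul C, eventually_all.2 fun i => ih i (h.2 i)]
        with s h1 h2
      exact fullRank_node.2 ⟨h1, h2⟩

theorem continuous_basis_pert {τ : OTree 𝓛} (D E : TTN n r τ) :
    Continuous fun s => (pert D E s).basis := by
  induction D with
  | leaf U =>
    cases E with
    | leaf U' => exact continuous_const.add (continuous_id.smul continuous_const)
  | @node m c C D ih =>
    cases E with
    | node C' D' =>
      refine continuous_matrix fun p a => ?_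
      change Continuous fun s : ℝ => ∑ l : (j : Fin m) → Fin (r (c j)),
        (C (a, l) + s * C' (a, l)) * ∏ j, (pert (D j) (D' j) s).basis (p j) (l j)
      refine continuous_finsetSum _ fun l _ => ?_
      refine (continuous_const.add (continuous_id.mul continuous_const)).mul ?_
      exact continuous_finsetProd _ fun j _ => (ih j (D' j)).matrix_elem _ _

theorem pert_zero {τ : OTree 𝓛} (D E : TTN n r τ) : pert D E 0 = D := by
  induction D with
  | leaf U =>
    cases E with
    | leaf U' => simp [pert]
  | @node m c C D ih =>
    cases E with
    | node C' D' => simp [pert, ih]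

theorem tendsto_basis_pert {τ : OTree 𝓛} (D E : TTN n r τ) :
    Tendsto (fun s => (pert D E s).basis) (𝓝[≠] 0) (𝓝 D.basis) := by
  have := (continuous_basis_pert D E).tendsto 0
  rw [pert_zero] at this
  exact this.mono_left nhdsWithin_le_nhds

end TTN

end Networks

/-! ### Curves of matrices of bounded rank -/

section RankCurves

/-- The first factor is `O(s)` and the second is `o(1)`, so the product is `o(s)`. Differentiability
of `g` is not needed. -/
theorem HasDerivAt.mul_of_eq_zero {f g : ℝ → ℝ} {f' : ℝ} (hf : HasDerivAt f f' 0) (hf0 : f 0 = 0)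
    (hg : Tendsto g (𝓝 0) (𝓝 0)) : HasDerivAt (fun s => f s * g s) 0 0 := by
  rw [hasDerivAt_iff_isLittleO]
  have h1 : f =O[𝓝 0] fun s => s - 0 := by
    have := hf.isBigO_sub
    simpa [hf0] using this
  have h2 : g =o[𝓝 0] fun _ => (1 : ℝ) := (Asymptotics.isLittleO_one_iff ℝ).2 hg
  simpa [hf0] using h1.mul_isLittleO h2

variable {a b c k : Type*} [Fintype a] [Fintype b] [Fintype c] [Fintype k] [DecidableEq k]

omit [Fintype b] [Fintype c] in
theorem hasDerivAt_const_mul_entries {A : ℝ → Matrix a b ℝ} {A' : Matrix a b ℝ}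
    (h : ∀ e f, HasDerivAt (fun s => A s e f) (A' e f) 0) (P : Matrix c a ℝ) (e : c) (f : b) :
    HasDerivAt (fun s => (P * A s) e f) ((P * A') e f) 0 := by
  simp only [Matrix.mul_apply]
  exact HasDerivAt.fun_sum fun j _ => (h j f).const_mul _

omit [Fintype a] [Fintype c] in
theorem hasDerivAt_mul_const_entries {A : ℝ → Matrix a b ℝ} {A' : Matrix a b ℝ}
    (h : ∀ e f, HasDerivAt (fun s => A s e f) (A' e f) 0) (P : Matrix b c ℝ) (e : a) (f : c) :
    HasDerivAt (fun s => (A s * P) e f) ((A' * P) e f) 0 := by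
  simp only [Matrix.mul_apply]
  exact HasDerivAt.fun_sum fun j _ => (h e j).mul_const _

/-- Skeleton decomposition: a matrix of rank at most `k` is recovered from `A R` and `L A` once the
`k × k` block `L A R` is invertible. Invertibility of the block forces both `L G` and `H R` to be
invertible. -/
theorem eq_mul_inv_mul_of_factor {A : Matrix a b ℝ} {G : Matrix a k ℝ} {H : Matrix k b ℝ}
    (hA : A = G * H) (L : Matrix k a ℝ) (R : Matrix b k ℝ) (hd : (L * A * R).det ≠ 0) :
    A = A * R * (L * A * R)⁻¹ * (L * A) := by
  have h1 : L * A * R = (L * G) * (H * R) := by rw [hA]; simp only [Matrix.mul_assoc]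
  rw [h1, Matrix.det_mul] at hd
  have hL : IsUnit (L * G).det := isUnit_iff_ne_zero.2 (left_ne_zero_of_mul hd)
  have hR : IsUnit (H * R).det := isUnit_iff_ne_zero.2 (right_ne_zero_of_mul hd)
  rw [h1, Matrix.mul_inv_rev]
  calc A = G * (((H * R) * (H * R)⁻¹) * ((L * G)⁻¹ * (L * G))) * H := by
        rw [Matrix.mul_nonsing_inv _ hR, Matrix.nonsing_inv_mul _ hL, Matrix.one_mul,
          Matrix.mul_one, hA]
    _ = _ := by rw [hA]; simp only [Matrix.mul_assoc]

/-- The velocity of a curve of matrices of rank at most `k` at a matrix `A 0` of rank `k` is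
orthogonal to the normal space. -/
theorem mul_deriv_mul_eq_zero_of_factor {A : ℝ → Matrix a b ℝ} {A' : Matrix a b ℝ}
    (h : ∀ e f, HasDerivAt (fun s => A s e f) (A' e f) 0)
    (hA : ∀ᶠ s in 𝓝 0, ∃ (G : Matrix a k ℝ) (H : Matrix k b ℝ), A s = G * H)
    {P : Matrix a a ℝ} {P' : Matrix b b ℝ} (hP : P * A 0 = 0) (hP' : A 0 * P' = 0)
    (L : Matrix k a ℝ) (R : Matrix b k ℝ) (hd : (L * A 0 * R).det ≠ 0) : P * A' * P' = 0 := by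
  have hc : Tendsto A (𝓝 0) (𝓝 (A 0)) :=
    tendsto_pi_nhds.2 fun e => tendsto_pi_nhds.2 fun f => (h e f).continuousAt.tendsto
  have hLA : Tendsto (fun s => L * A s) (𝓝 0) (𝓝 (L * A 0)) :=
    tendsto_matrix_mul tendsto_const_nhds hc
  have hLAR : Tendsto (fun s => L * A s * R) (𝓝 0) (𝓝 (L * A 0 * R)) :=
    tendsto_matrix_mul hLA tendsto_const_nhds
  have hg : Tendsto (fun s => (L * A s * R)⁻¹ * (L * A s * P')) (𝓝 0)
      (𝓝 ((L * A 0 * R)⁻¹ * (L * A 0 * P'))) :=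
    tendsto_matrix_mul (tendsto_inv_of_det_ne_zero hd hLAR)
      (tendsto_matrix_mul hLA tendsto_const_nhds)
  have h0 : (L * A 0 * R)⁻¹ * (L * A 0 * P') = 0 := by
    rw [Matrix.mul_assoc L (A 0) P', hP', Matrix.mul_zero, Matrix.mul_zero]
  ext e f
  have h1 := hasDerivAt_mul_const_entries (hasDerivAt_const_mul_entries h P) P' e f
  refine h1.unique ?_
  -- By the skeleton decomposition `P A P' = (P A R) ((L A R)⁻¹ L A P')` near `0`. Both factors
  -- vanish at `0`: the first is differentiable there and the second continuous, so the derivative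
  -- of the product is zero.
  have h2 : HasDerivAt (fun s => ∑ j, (P * A s * R) e j *
      ((L * A s * R)⁻¹ * (L * A s * P')) j f) (∑ j : k, (0 : ℝ)) 0 := by
    refine HasDerivAt.fun_sum fun j _ => ?_
    refine HasDerivAt.mul_of_eq_zero
      (hasDerivAt_mul_const_entries (hasDerivAt_const_mul_entries h P) R e j) ?_ ?_
    · rw [hP, Matrix.zero_mul]; rfl
    · rw [h0] at hg
      exact tendsto_pi_nhds.1 (tendsto_pi_nhds.1 hg j) f
  rw [Finset.sum_const_zero] at h2
  refine h2.congr_of_eventuallyEq ?_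
  filter_upwards [hA, eventually_det_ne_zero hd hLAR] with s hs hds
  obtain ⟨G, H, hGH⟩ := hs
  have h3 := eq_mul_inv_mul_of_factor hGH L R hds
  rw [← Matrix.mul_apply]
  refine congrFun (congrFun ?_ e) f
  calc P * A s * P' = P * (A s * R * (L * A s * R)⁻¹ * (L * A s)) * P' := by rw [← h3]
    _ = _ := by simp only [Matrix.mul_assoc]

end RankCurves

/-! ### Pairs of a point and a normal vector -/

section Normal

variable {𝓛 : Type*} {n : 𝓛 → ℕ} {r : OTree 𝓛 → ℕ}

theorem continuous_ten₀ {α β : Type*} [Fintype α] [Fintype β] :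
    Continuous (ten₀ : Matrix α β ℝ → EuclideanSpace ℝ (α × β)) :=
  (PiLp.continuous_toLp 2 _).comp
    (continuous_pi fun p => (continuous_id.matrix_elem p.1 p.2 : _))

theorem continuous_mat₀ {α β : Type*} [Fintype α] [Fintype β] :
    Continuous (mat₀ : EuclideanSpace ℝ (α × β) → Matrix α β ℝ) :=
  continuous_matrix fun a b => (EuclideanSpace.proj (𝕜 := ℝ) (a, b)).continuous

theorem continuous_ten {α : Type*} {m : ℕ} {γ : Fin m → Type*} [Fintype α] [∀ j, Fintype (γ j)]
    (i : Fin m) : Continuous (ten i : Matrix (γ i) (α × ((j : {j // j ≠ i}) → γ j)) ℝ →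
      EuclideanSpace ℝ (α × ((j : Fin m) → γ j))) :=
  (PiLp.continuous_toLp 2 _).comp
    (continuous_pi fun _ => Continuous.matrix_elem
      (A := fun M : Matrix (γ i) (α × ((j : {j // j ≠ i}) → γ j)) ℝ => M) continuous_id _ _)

theorem tendsto_vMat {X α : Type*} {l : Filter X} {m : ℕ} {γ κ : Fin m → Type*} [Fintype α]
    [∀ j, Fintype (κ j)] (i : Fin m)
    {Q : X → Matrix (α × ((j : {j // j ≠ i}) → κ j)) (κ i) ℝ}
    {U : X → (j : Fin m) → Matrix (γ j) (κ j) ℝ} {Q₀ : Matrix _ (κ i) ℝ}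
    {U₀ : (j : Fin m) → Matrix (γ j) (κ j) ℝ} (hQ : Tendsto Q l (𝓝 Q₀))
    (hU : ∀ j, Tendsto (fun s => U s j) l (𝓝 (U₀ j))) :
    Tendsto (fun s => vMat i (Q s) (U s)) l (𝓝 (vMat i Q₀ U₀)) := by
  refine tendsto_pi_nhds.2 fun p => tendsto_pi_nhds.2 fun b => ?_
  refine tendsto_finsetSum _ fun l _ => Tendsto.mul ?_ (tendsto_finsetProd _ fun j _ => ?_)
  · exact tendsto_pi_nhds.1 (tendsto_pi_nhds.1 hQ _) _
  · exact tendsto_pi_nhds.1 (tendsto_pi_nhds.1 (hU j) _) _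

theorem tendsto_prolongL {X α β : Type*} {l : Filter X} {m : ℕ} {γ : Fin m → Type*} [Fintype α]
    [Fintype β] [∀ j, Fintype (γ j)] (i : Fin m)
    {W : X → Matrix (α × ((j : {j // j ≠ i}) → γ j)) β ℝ} {W₀ : Matrix _ β ℝ}
    {Y : X → EuclideanSpace ℝ (β × γ i)} {Y₀ : EuclideanSpace ℝ (β × γ i)}
    (hW : Tendsto W l (𝓝 W₀)) (hY : Tendsto Y l (𝓝 Y₀)) :
    Tendsto (fun s => prolongL i (W s) (Y s)) l (𝓝 (prolongL i W₀ Y₀)) :=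
  ((continuous_ten i).tendsto _).comp
    (tendsto_transpose (tendsto_matrix_mul hW ((continuous_mat₀.tendsto _).comp hY)))

variable (n r) in
/-- The pairs `(Y, Z)` of a point `Y` of the manifold and a normal vector `Z` at `Y`. -/
def normalPairs (τ : OTree 𝓛) : Set (V n r τ × V n r τ) :=
  {p | p.1 ∈ manifold n r τ ∧ ∀ (x : ℝ → V n r τ) (v : V n r τ),
    (∀ᶠ s in 𝓝 0, x s ∈ manifold n r τ) → x 0 = p.1 → HasDerivAt x v 0 → ⟪p.2, v⟫ = 0}

theorem fst_mem_closure_of_mem_normalPairs {τ : OTree 𝓛} {p : V n r τ × V n r τ}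
    (h : p ∈ closure (normalPairs n r τ)) : p.1 ∈ closure (manifold n r τ) :=
  map_mem_closure continuous_fst h fun _ hq => hq.1

theorem zero_mem_closure_normalPairs {τ : OTree 𝓛} {Y : V n r τ}
    (h : Y ∈ closure (manifold n r τ)) : (Y, 0) ∈ closure (normalPairs n r τ) :=
  map_mem_closure (f := fun Y => (Y, 0)) (by fun_prop) h
    fun _ hq => ⟨hq, fun _ _ _ _ _ => inner_zero_left _⟩

/-- Adding a small multiple of a full-rank network makes any network of full rank. Hence all
intermediate values of the integrator, which may be rank deficient, lie in the closure, provided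
that the manifold has a point at all. -/
theorem tensor_mem_closure_manifold {τ : OTree 𝓛} (D : TTN n r τ)
    (h : (manifold n r τ).Nonempty) : D.tensor ∈ closure (manifold n r τ) := by
  obtain ⟨_, E, hE, -, -⟩ := h
  refine mem_closure_of_tendsto (f := fun s => (TTN.pert D E s).tensor) (b := 𝓝[≠] (0 : ℝ)) ?_
    ((TTN.FullRank.eventually_pert D hE).mono fun s hs => hs.tensor_mem_manifold)
  exact (continuous_ten₀.tendsto _).comp (tendsto_transpose (TTN.tendsto_basis_pert D E))

theorem rank_mat₀_of_mem_manifold {τ : OTree 𝓛} {Y : V n r τ} (h : Y ∈ manifold n r τ) :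
    (mat₀ Y).rank = r τ := by
  obtain ⟨D, hD, -, rfl⟩ := h
  rw [TTN.mat₀_tensor, Matrix.rank_transpose]
  exact rank_eq_iff_exists_left_inv.2 hD.exists_left_inv_basis

/-! ### Normal vectors at a node and on its subtrees. -/

variable {m : ℕ} {c : Fin m → OTree 𝓛}

theorem manifold_child_nonempty (h : (manifold n r (.node m c)).Nonempty) (i : Fin m) :
    (manifold n r (c i)).Nonempty := by
  obtain ⟨_, D, h1, h2, -⟩ := h
  cases D with
  | node C D => exact ⟨_, D i, h1.2.2 i, (h2 i).2, rfl⟩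

/-- The prolongation as a continuous linear map between the spaces attached to a tree. -/
def prolongV (i : Fin m)
    (W : Matrix (Fin (r (.node m c)) × ((j : {j // j ≠ i}) → Idx n (c j))) (Fin (r (c i))) ℝ) :
    V n r (c i) →L[ℝ] V n r (.node m c) :=
  prolongL (γ := fun j => Idx n (c j)) i W

/-- The restriction as a continuous linear map between the spaces attached to a tree. -/
def restrictV (i : Fin m)
    (W : Matrix (Fin (r (.node m c)) × ((j : {j // j ≠ i}) → Idx n (c j))) (Fin (r (c i))) ℝ) :
    V n r (.node m c) →L[ℝ] V n r (c i) :=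
  restrictL (γ := fun j => Idx n (c j)) i W

section

variable (i : Fin m)
  (W : Matrix (Fin (r (.node m c)) × ((j : {j // j ≠ i}) → Idx n (c j))) (Fin (r (c i))) ℝ)

theorem inner_prolongV (Y : V n r (c i)) (Z : V n r (.node m c)) :
    ⟪prolongV i W Y, Z⟫ = ⟪Y, restrictV i W Z⟫ :=
  inner_prolongL (γ := fun j => Idx n (c j)) i W Y Z

theorem norm_prolongV {W : Matrix (Fin (r (.node m c)) × ((j : {j // j ≠ i}) → Idx n (c j)))
    (Fin (r (c i))) ℝ} (hW : Wᵀ * W = 1) (Y : V n r (c i)) : ‖prolongV i W Y‖ = ‖Y‖ :=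
  norm_prolongL (γ := fun j => Idx n (c j)) i hW Y

theorem norm_restrictV_le {W : Matrix (Fin (r (.node m c)) × ((j : {j // j ≠ i}) → Idx n (c j)))
    (Fin (r (c i))) ℝ} (hW : Wᵀ * W = 1) (Z : V n r (.node m c)) : ‖restrictV i W Z‖ ≤ ‖Z‖ :=
  norm_restrictL_le (γ := fun j => Idx n (c j)) i hW Z

end

theorem exists_factor_of_mem_manifold (i : Fin m) {X : V n r (.node m c)}
    (hX : X ∈ manifold n r (.node m c)) : ∃ (D : TTN n r (c i))
      (W : Matrix (Fin (r (.node m c)) × ((j : {j // j ≠ i}) → Idx n (c j))) (Fin (r (c i))) ℝ),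
      D.FullRank ∧ mat (γ := fun j => Idx n (c j)) i X = D.basis * Wᵀ := by
  obtain ⟨D, h1, -, rfl⟩ := hX
  cases D with
  | node C D =>
    exact ⟨D i, _, h1.2.2 i,
      mat_tucker (γ := fun j => Idx n (c j)) (κ := fun j => Fin (r (c j))) i C _⟩

/-- With `Matᵢ(X) = U Wᵀ` and `U` the basis of a full-rank branch, the restriction is that branch
with `Wᵀ N` applied at its root. The rank hypothesis forces the square matrix `Wᵀ N` to be
invertible. -/
theorem restrict_mem_manifold (i : Fin m)
    (N : Matrix (Fin (r (.node m c)) × ((j : {j // j ≠ i}) → Idx n (c j))) (Fin (r (c i))) ℝ)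
    {X : V n r (.node m c)} (hX : X ∈ manifold n r (.node m c))
    (h : (mat₀ (restrictV i N X)).rank = r (c i)) : restrictV i N X ∈ manifold n r (c i) := by
  obtain ⟨D, W, hD, hW⟩ := exists_factor_of_mem_manifold i hX
  have h1 : mat₀ (restrictV i N X) = (D.basis * (Wᵀ * N))ᵀ := by
    rw [← Matrix.mul_assoc, ← hW]; rfl
  have h2 : restrictV i N X = (D.mulTop (Wᵀ * N)).tensor := by
    rw [TTN.tensor_mulTop, ← h1, ten₀_mat₀]
  obtain ⟨K, hK⟩ := rank_eq_iff_exists_right_inv.1 h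
  rw [h1, Matrix.transpose_mul, Matrix.mul_assoc] at hK
  have h3 := congrArg Matrix.transpose (mul_eq_one_comm.1 hK)
  rw [Matrix.transpose_mul, Matrix.transpose_one, Matrix.transpose_transpose] at h3
  rw [h2]
  exact (hD.mulTop (mul_eq_one_comm.1 h3)).tensor_mem_manifold

/-- Prolongations map limits of normal pairs to limits of normal pairs. -/
theorem prolong_mem_closure_normalPairs (hne : (manifold n r (.node m c)).Nonempty) (i : Fin m)
    (D : (j : Fin m) → TTN n r (c j))
    {Q : Matrix (Fin (r (.node m c)) × ((j : {j // j ≠ i}) → Fin (r (c j)))) (Fin (r (c i))) ℝ}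
    (hQ : Qᵀ * Q = 1) (hD : ∀ j, j ≠ i → (D j).basisᵀ * (D j).basis = 1)
    {W : Matrix (Fin (r (.node m c)) × ((j : {j // j ≠ i}) → Idx n (c j))) (Fin (r (c i))) ℝ}
    (hW : W = vMat (γ := fun j => Idx n (c j)) i Q fun j => (D j).basis)
    {p : V n r (c i) × V n r (c i)} (hp : p ∈ closure (normalPairs n r (c i))) :
    (prolongV i W p.1, prolongV i W p.2) ∈ closure (normalPairs n r (.node m c)) := by
  -- By continuity of the prolongation, true normal pairs suffice. Their images need only lie in the
  -- closure, because `W` itself may come from a rank-deficient network.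
  suffices h : ∀ q ∈ normalPairs n r (c i),
      (prolongV i W q.1, prolongV i W q.2) ∈ closure (normalPairs n r (.node m c)) by
    have := map_mem_closure
      (f := fun q : V n r (c i) × V n r (c i) => (prolongV i W q.1, prolongV i W q.2))
      (by fun_prop) hp h
    rwa [closure_closure] at this
  clear hp p
  rintro ⟨Y, Z⟩ ⟨hY, hZ⟩
  dsimp only at hY hZ ⊢
  obtain ⟨_, E, hE, -, -⟩ := hne
  obtain ⟨DY, hDY, -, hDY'⟩ := id hY
  cases E with | @node _ _ C E =>
  rw [TTN.fullRank_node] at hE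
  set Q' := (mat (γ := fun j => Fin (r (c j))) i C)ᵀ with hQ'
  set Ws : ℝ → Matrix (Fin (r (.node m c)) × ((j : {j // j ≠ i}) → Idx n (c j)))
    (Fin (r (c i))) ℝ := fun s => vMat (γ := fun j => Idx n (c j)) i (Q + s • Q')
      fun j => (TTN.pert (D j) (E j) s).basis with hWs
  have hQs : Tendsto (fun s : ℝ => Q + s • Q') (𝓝[≠] 0) (𝓝 Q) := by
    have h : Continuous fun s : ℝ => Q + s • Q' :=
      continuous_const.add (continuous_id.smul continuous_const)
    have := (h.tendsto 0).mono_left (nhdsWithin_le_nhds (s := {0}ᶜ))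
    simpa using this
  have hWt : Tendsto Ws (𝓝[≠] 0) (𝓝 W) := by
    rw [hW]
    exact tendsto_vMat (γ := fun j => Idx n (c j)) i hQs
      fun j => TTN.tendsto_basis_pert (D j) (E j)
  have hWW : Wᵀ * W = 1 := by
    rw [hW]; exact vMat_orthonormal (γ := fun j => Idx n (c j)) i hQ hD
  -- The normal vector is prolonged with `(linv (Ws s))ᵀ` rather than `Ws s`. The adjoint
  -- restriction is then an exact left inverse of the prolongation by `Ws s`, although the perturbed
  -- `Ws s` has lost its orthonormal columns. Both matrices tend to `W`.
  refine mem_closure_of_tendsto (b := 𝓝[≠] (0 : ℝ))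
    (f := fun s => (prolongV i (Ws s) Y, prolongV i (linv (Ws s))ᵀ Z)) ?_ ?_
  · refine Tendsto.prodMk_nhds ?_ ?_
    · exact tendsto_prolongL (γ := fun j => Idx n (c j)) i hWt tendsto_const_nhds
    · refine tendsto_prolongL (γ := fun j => Idx n (c j)) i ?_ tendsto_const_nhds
      exact tendsto_transpose (tendsto_linv hWW hWt)
  · filter_upwards [hE.1.eventually_add_smul (ten (γ := fun j => Fin (r (c j))) i Qᵀ),
      eventually_all.2 fun j => TTN.FullRank.eventually_pert (D j) (hE.2 j),
      eventually_linv_mul hWW hWt] with s h1 h2 h3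
    refine ⟨?_, ?_⟩
    · have hC : ten (γ := fun j => Fin (r (c j))) i Qᵀ + s • C =
          ten (γ := fun j => Fin (r (c j))) i (Q + s • Q')ᵀ := by
        apply mat_injective i
        rw [mat_add, mat_smul, mat_ten, mat_ten, Matrix.transpose_add, Matrix.transpose_smul,
          Matrix.transpose_transpose]
      rw [hC] at h1
      have hF : (TTN.node (ten (γ := fun j => Fin (r (c j))) i (Q + s • Q')ᵀ)
          (Function.update (fun j => TTN.pert (D j) (E j) s) i DY)).FullRank := by
        refine TTN.fullRank_node.2 ⟨h1, fun j => ?_⟩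
        by_cases hj : j = i
        · subst hj; rwa [Function.update_self]
        · rw [Function.update_of_ne hj]; exact h2 j
      have hT := hF.tensor_mem_manifold
      rw [TTN.tensor_node_update, Function.update_self, hDY'] at hT
      rw [vMat_congr (γ := fun j => Idx n (c j)) i _ (U' := fun j => (TTN.pert (D j) (E j) s).basis)
        fun j hj => by rw [Function.update_of_ne hj]] at hT
      exact hT
    · intro x v hx hx0 hv
      rw [inner_prolongV]
      have hR0 : restrictV i (linv (Ws s))ᵀ (x 0) = Y := by
        apply mat₀_injective
        rw [hx0]
        calc mat₀ (restrictV i (linv (Ws s))ᵀ (prolongV i (Ws s) Y)) =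
            (linv (Ws s))ᵀᵀ * (mat (γ := fun j => Idx n (c j)) i
              (prolongL (γ := fun j => Idx n (c j)) i (Ws s) Y))ᵀ :=
              mat₀_restrictL (γ := fun j => Idx n (c j)) i _ _
          _ = mat₀ Y := by
            rw [mat_prolongL, Matrix.transpose_transpose, Matrix.transpose_mul,
              Matrix.transpose_transpose, Matrix.transpose_transpose, ← Matrix.mul_assoc, h3,
              Matrix.one_mul]
      -- A curve in the large manifold restricts to a curve through `Y` in the manifold of the
      -- subtree: near `0` its rank stays full. Normality of `Z` there gives, by adjointness,
      -- normality of the prolonged vector.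
      refine hZ (fun σ => restrictV i (linv (Ws s))ᵀ (x σ)) _ ?_ hR0
        ((restrictV i (linv (Ws s))ᵀ).hasFDerivAt.comp_hasDerivAt 0 hv)
      have hcont : Tendsto (fun σ => mat₀ (restrictV i (linv (Ws s))ᵀ (x σ))) (𝓝 0)
          (𝓝 (mat₀ Y)) := by
        rw [← hR0]
        exact ((continuous_mat₀.comp (restrictV i (linv (Ws s))ᵀ).continuous).tendsto _).comp
          hv.continuousAt.tendsto
      filter_upwards [hx, eventually_rank_eq_of_tendsto
        ((rank_mat₀_of_mem_manifold hY).trans (Fintype.card_fin _).symm) hcont] with σ h4 h5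
      exact restrict_mem_manifold i _ h4 (h5.trans (Fintype.card_fin _))

/-- At a point of the form `π(U S)`, the tensors annihilated by `Uᵀ` and by `W` in the mode `i`
are limits of normal vectors. -/
theorem mem_closure_normalPairs_of_mul_eq_zero (hne : (manifold n r (.node m c)).Nonempty)
    (i : Fin m) (D : (j : Fin m) → TTN n r (c j))
    {Q : Matrix (Fin (r (.node m c)) × ((j : {j // j ≠ i}) → Fin (r (c j)))) (Fin (r (c i))) ℝ}
    (S : Matrix (Fin (r (c i))) (Fin (r (c i))) ℝ)
    (hQ : Qᵀ * Q = 1) (hD : ∀ j, (D j).basisᵀ * (D j).basis = 1)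
    {W : Matrix (Fin (r (.node m c)) × ((j : {j // j ≠ i}) → Idx n (c j))) (Fin (r (c i))) ℝ}
    (hW : W = vMat (γ := fun j => Idx n (c j)) i Q fun j => (D j).basis)
    {Z : V n r (.node m c)} (hZ : (D i).basisᵀ * mat (γ := fun j => Idx n (c j)) i Z = 0)
    (hZ' : mat (γ := fun j => Idx n (c j)) i Z * W = 0) :
    (prolongV i W ((D i).mulTop S).tensor, Z) ∈ closure (normalPairs n r (.node m c)) := by
  obtain ⟨_, E, hE, -, -⟩ := hne
  cases E with | @node _ _ C E =>
  rw [TTN.fullRank_node] at hE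
  set Q' := (mat (γ := fun j => Fin (r (c j))) i C)ᵀ with hQ'
  set Ds : ℝ → (j : Fin m) → TTN n r (c j) := fun s j => TTN.pert (D j) (E j) s with hDs
  set Us : ℝ → Matrix (Idx n (c i)) (Fin (r (c i))) ℝ := fun s => (Ds s i).basis with hUs
  -- `S` may be singular. The shift makes it invertible for small `s ≠ 0`.
  set Ss : ℝ → Matrix (Fin (r (c i))) (Fin (r (c i))) ℝ := fun s => S + s • 1 with hSs
  set Ws : ℝ → Matrix (Fin (r (.node m c)) × ((j : {j // j ≠ i}) → Idx n (c j)))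
    (Fin (r (c i))) ℝ := fun s => vMat (γ := fun j => Idx n (c j)) i (Q + s • Q')
      fun j => (Ds s j).basis with hWs
  have hQs : Tendsto (fun s : ℝ => Q + s • Q') (𝓝[≠] 0) (𝓝 Q) := by
    have h : Continuous fun s : ℝ => Q + s • Q' :=
      continuous_const.add (continuous_id.smul continuous_const)
    have := (h.tendsto 0).mono_left (nhdsWithin_le_nhds (s := {0}ᶜ))
    simpa using this
  have hSt : Tendsto Ss (𝓝[≠] 0) (𝓝 S) := by
    have h : Continuous Ss := continuous_const.add (continuous_id.smul continuous_const)
    have := (h.tendsto 0).mono_left (nhdsWithin_le_nhds (s := {0}ᶜ))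
    simpa [hSs] using this
  have hUt : Tendsto Us (𝓝[≠] 0) (𝓝 (D i).basis) := TTN.tendsto_basis_pert (D i) (E i)
  have hWt : Tendsto Ws (𝓝[≠] 0) (𝓝 W) := by
    rw [hW]
    exact tendsto_vMat (γ := fun j => Idx n (c j)) i hQs
      fun j => TTN.tendsto_basis_pert (D j) (E j)
  have hWW : Wᵀ * W = 1 := by
    rw [hW]; exact vMat_orthonormal (γ := fun j => Idx n (c j)) i hQ fun j _ => hD j
  -- Oblique projections with `P U = 0` and `Wᵀ P' = 0` for the perturbed, no longer orthonormal,
  -- `U` and `W`. In the limit they become `1 - U Uᵀ` and `1 - W Wᵀ`, which fix `Z` by the two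
  -- hypotheses on it.
  set P : ℝ → Matrix (Idx n (c i)) (Idx n (c i)) ℝ := fun s => 1 - Us s * linv (Us s) with hP
  set P' : ℝ → Matrix (Fin (r (.node m c)) × ((j : {j // j ≠ i}) → Idx n (c j)))
    (Fin (r (.node m c)) × ((j : {j // j ≠ i}) → Idx n (c j))) ℝ :=
      fun s => 1 - (linv (Ws s))ᵀ * (Ws s)ᵀ with hP'
  have hY : ∀ s, prolongV i (Ws s) ((Ds s i).mulTop (Ss s)).tensor =
      (TTN.node (ten (γ := fun j => Fin (r (c j))) i (Ss s * (Q + s • Q')ᵀ)) (Ds s)).tensor :=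
    fun s => (TTN.tensor_node_update_mulTop i _ _ _).symm
  refine mem_closure_of_tendsto (b := 𝓝[≠] (0 : ℝ))
    (f := fun s => (prolongV i (Ws s) ((Ds s i).mulTop (Ss s)).tensor,
      (sandwichL (γ := fun j => Idx n (c j)) i (P s)ᵀ (P' s)ᵀ Z : V n r (.node m c)))) ?_ ?_
  · refine Tendsto.prodMk_nhds ?_ ?_
    · refine tendsto_prolongL (γ := fun j => Idx n (c j)) i hWt ?_
      simp only [TTN.tensor_mulTop]
      exact (continuous_ten₀.tendsto _).comp (tendsto_transpose (tendsto_matrix_mul hUt hSt))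
    · have h1 : Tendsto (fun s => (P s)ᵀ * mat (γ := fun j => Idx n (c j)) i Z * (P' s)ᵀ) (𝓝[≠] 0)
          (𝓝 ((1 - (D i).basis * (D i).basisᵀ)ᵀ * mat (γ := fun j => Idx n (c j)) i Z *
            (1 - Wᵀᵀ * Wᵀ)ᵀ)) := by
        refine tendsto_matrix_mul (tendsto_matrix_mul (tendsto_transpose ?_) tendsto_const_nhds)
          (tendsto_transpose ?_)
        · exact tendsto_const_nhds.sub (tendsto_matrix_mul hUt (tendsto_linv (hD i) hUt))
        · exact tendsto_const_nhds.sub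
            (tendsto_matrix_mul (tendsto_transpose (tendsto_linv hWW hWt)) (tendsto_transpose hWt))
      have h2 : (1 - (D i).basis * (D i).basisᵀ)ᵀ * mat (γ := fun j => Idx n (c j)) i Z *
            (1 - Wᵀᵀ * Wᵀ)ᵀ = mat (γ := fun j => Idx n (c j)) i Z := by
        rw [Matrix.transpose_sub, Matrix.transpose_sub, Matrix.transpose_mul, Matrix.transpose_mul,
          Matrix.transpose_transpose, Matrix.transpose_transpose, Matrix.transpose_one,
          Matrix.transpose_one, Matrix.sub_mul, Matrix.mul_assoc, hZ, Matrix.mul_zero, sub_zero,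
          Matrix.one_mul, Matrix.mul_sub, ← Matrix.mul_assoc, hZ', Matrix.zero_mul, sub_zero,
          Matrix.mul_one]
      rw [h2] at h1
      have h3 := ((continuous_ten (γ := fun j => Idx n (c j)) i).tendsto _).comp h1
      have h4 : ten (γ := fun j => Idx n (c j)) i (mat (γ := fun j => Idx n (c j)) i Z) = Z :=
        ten_mat i Z
      rw [h4] at h3
      exact h3
  · filter_upwards [hE.1.eventually_add_smul (ten (γ := fun j => Fin (r (c j))) i Qᵀ),
      eventually_all.2 fun j => TTN.FullRank.eventually_pert (D j) (hE.2 j),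
      eventually_linv_mul hWW hWt, eventually_linv_mul (hD i) hUt,
      eventually_det_add_smul_ne_zero S] with s h1 h2 h3 h3' hdet
    have hSinv : (Ss s)⁻¹ * Ss s = 1 := Matrix.nonsing_inv_mul _ (isUnit_iff_ne_zero.2 hdet)
    refine ⟨?_, ?_⟩
    · have hC : ten (γ := fun j => Fin (r (c j))) i Qᵀ + s • C =
          ten (γ := fun j => Fin (r (c j))) i (Q + s • Q')ᵀ := by
        apply mat_injective i
        rw [mat_add, mat_smul, mat_ten, mat_ten, Matrix.transpose_add, Matrix.transpose_smul,
          Matrix.transpose_transpose]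
      rw [hC] at h1
      dsimp only
      rw [hY, ten_mul_eq_tucker (κ := fun j => Fin (r (c j))) i]
      refine (TTN.fullRank_node.2 ⟨FullMultirank.tucker h1 fun j => ?_, h2⟩).tensor_mem_manifold
      by_cases hj : j = i
      · subst hj; rw [Function.update_self]; exact ⟨_, hSinv⟩
      · rw [Function.update_of_ne hj]; exact ⟨1, Matrix.one_mul 1⟩
    · intro x v hx hx0 hv
      have hx0' : mat (γ := fun j => Idx n (c j)) i (x 0) = Us s * Ss s * (Ws s)ᵀ := by
        rw [hx0]
        have := mat_prolongL (γ := fun j => Idx n (c j)) i (Ws s) ((Ds s i).mulTop (Ss s)).tensor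
        rw [TTN.mat₀_tensor, TTN.basis_mulTop, Matrix.transpose_transpose] at this
        exact this
      have hW3 : (Ws s)ᵀ * (linv (Ws s))ᵀ = 1 := by
        rw [← Matrix.transpose_mul, h3, Matrix.transpose_one]
      -- Along a curve in the manifold the `i`-th matricization factors through `r (c i)` columns,
      -- and at the base point `L A R` equals the invertible `Ss s`. The lemma on matrices of
      -- bounded rank therefore applies to its velocity.
      have key : P s * mat (γ := fun j => Idx n (c j)) i v * P' s = 0 := by
        refine mul_deriv_mul_eq_zero_of_factor (k := Fin (r (c i)))
          (A := fun σ => mat (γ := fun j => Idx n (c j)) i (x σ)) ?_ ?_ ?_ ?_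
          (linv (Us s)) (linv (Ws s))ᵀ ?_
        · intro e f
          exact (EuclideanSpace.proj (𝕜 := ℝ) _).hasFDerivAt.comp_hasDerivAt 0 hv
        · filter_upwards [hx] with σ hσ
          obtain ⟨D', W', -, h⟩ := exists_factor_of_mem_manifold i hσ
          exact ⟨_, _, h⟩
        · rw [hx0', hP, Matrix.sub_mul, Matrix.one_mul, sub_eq_zero]
          simp only [Matrix.mul_assoc]
          rw [← Matrix.mul_assoc (linv _) (Us s), h3', Matrix.one_mul]
        · rw [hx0', hP', Matrix.mul_sub, Matrix.mul_one, sub_eq_zero]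
          simp only [Matrix.mul_assoc]
          rw [← Matrix.mul_assoc (Ws s)ᵀ, hW3, Matrix.one_mul]
        · rw [hx0']
          have : linv (Us s) * (Us s * Ss s * (Ws s)ᵀ) * (linv (Ws s))ᵀ =
              (linv (Us s) * Us s) * Ss s * ((Ws s)ᵀ * (linv (Ws s))ᵀ) := by
            simp only [Matrix.mul_assoc]
          rw [this, h3', hW3, Matrix.one_mul, Matrix.mul_one]
          exact hdet
      refine (inner_sandwichL (γ := fun j => Idx n (c j)) i _ _ Z v).trans ?_
      have h0 : sandwichL (γ := fun j => Idx n (c j)) i (P s)ᵀᵀ (P' s)ᵀᵀ v = 0 := by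
        apply mat_injective i
        refine (mat_sandwichL (γ := fun j => Idx n (c j)) i _ _ v).trans ?_
        rw [Matrix.transpose_transpose, Matrix.transpose_transpose, key]
        rfl
      exact (congrArg (inner ℝ Z) h0).trans (inner_zero_right _)

end Normal

/-! ### The local error -/

section Local

variable {𝓛 : Type*} {n : 𝓛 → ℕ} {r : OTree 𝓛 → ℕ}

/-- The constant in the bounds for one step on the tree `τ`. -/
def cst : OTree 𝓛 → ℝ
  | .leaf _ => 1
  | .node _ c => ∑ i, (cst (c i) + 2) + 1

theorem cst_nonneg (τ : OTree 𝓛) : 0 ≤ cst τ := by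
  induction τ with
  | leaf l => exact zero_le_one
  | node m c ih =>
    have : 0 ≤ ∑ i, (cst (c i) + 2) := Finset.sum_nonneg fun i _ => by linarith [ih i]
    rw [cst]; linarith

/-- On the ball of radius `R` about `Y₀`, the function `F` is `η`-close to `g` and `ε`-close to
being tangential; it is bounded by `B`. -/
structure LocalHyp (τ : OTree 𝓛) (F : ℝ → V n r τ → V n r τ) (g : ℝ → V n r τ) (t₀ t₁ : ℝ)
    (Y₀ : V n r τ) (B η ε R : ℝ) : Prop where
  bound : ∀ t ∈ Icc t₀ t₁, ∀ Y ∈ closure (manifold n r τ), ‖F t Y‖ ≤ B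
  close : ∀ t ∈ Icc t₀ t₁, ∀ Y ∈ closure (manifold n r τ), ‖Y - Y₀‖ ≤ R → ‖F t Y - g t‖ ≤ η
  normal : ∀ t ∈ Icc t₀ t₁, ∀ p ∈ closure (normalPairs n r τ), ‖p.1 - Y₀‖ ≤ R →
    ⟪p.2, F t p.1⟫ ≤ ε * ‖p.2‖

/-- Used to restart the estimates from an intermediate value: the distance already travelled is paid
for by the radius. -/
theorem LocalHyp.shift {τ : OTree 𝓛} {F : ℝ → V n r τ → V n r τ} {g : ℝ → V n r τ} {t₀ t₁ : ℝ}
    {Y₀ Y₁ : V n r τ} {B η ε R R' : ℝ} (H : LocalHyp τ F g t₀ t₁ Y₀ B η ε R)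
    (h : ‖Y₁ - Y₀‖ + R' ≤ R) : LocalHyp τ F g t₀ t₁ Y₁ B η ε R' := by
  have key : ∀ Y, ‖Y - Y₁‖ ≤ R' → ‖Y - Y₀‖ ≤ R := fun Y hY => by
    have := norm_sub_le_norm_sub_add_norm_sub Y Y₁ Y₀
    linarith
  exact ⟨H.bound, fun t ht Y hY hR => H.close t ht Y hY (key Y hR),
    fun t ht p hp hR => H.normal t ht p hp (key _ hR)⟩

variable {m : ℕ} {c : Fin m → OTree 𝓛}

/-- Since `W` has orthonormal columns, prolongation is an isometry and restriction, its adjoint, a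
contraction. Together with the inheritance of normal pairs this passes `B`, `η`, `ε` and `R` to the
subtree unchanged. -/
theorem LocalHyp.subF {F : ℝ → V n r (.node m c) → V n r (.node m c)}
    {g : ℝ → V n r (.node m c)} {t₀ t₁ : ℝ} {B η ε R : ℝ} (i : Fin m)
    (hne : (manifold n r (.node m c)).Nonempty) (D : (j : Fin m) → TTN n r (c j))
    {Q : Matrix (Fin (r (.node m c)) × ((j : {j // j ≠ i}) → Fin (r (c j)))) (Fin (r (c i))) ℝ}
    (hQ : Qᵀ * Q = 1) (hD : ∀ j, j ≠ i → (D j).basisᵀ * (D j).basis = 1)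
    {W : Matrix (Fin (r (.node m c)) × ((j : {j // j ≠ i}) → Idx n (c j))) (Fin (r (c i))) ℝ}
    (hW : W = vMat (γ := fun j => Idx n (c j)) i Q fun j => (D j).basis) {Y₀ : V n r (c i)}
    (H : LocalHyp (.node m c) F g t₀ t₁ (prolongV i W Y₀) B η ε R) :
    LocalHyp (c i) (subF i W F) (fun t => restrictV i W (g t)) t₀ t₁ Y₀ B η ε R := by
  have hWW : Wᵀ * W = 1 := by
    rw [hW]; exact vMat_orthonormal (γ := fun j => Idx n (c j)) i hQ hD
  have hcl : ∀ p ∈ closure (normalPairs n r (c i)), (prolongV i W p.1, prolongV i W p.2) ∈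
      closure (normalPairs n r (.node m c)) := fun p hp =>
    prolong_mem_closure_normalPairs hne i D hQ hD hW hp
  have hcl' : ∀ Y ∈ closure (manifold n r (c i)), prolongV i W Y ∈
      closure (manifold n r (.node m c)) := fun Y hY =>
    fst_mem_closure_of_mem_normalPairs (hcl _ (zero_mem_closure_normalPairs hY))
  have hdist : ∀ Y, ‖prolongV i W Y - prolongV i W Y₀‖ = ‖Y - Y₀‖ := fun Y => by
    rw [← map_sub, norm_prolongV i hWW]
  refine ⟨fun t ht Y hY => ?_, fun t ht Y hY hR => ?_, fun t ht p hp hR => ?_⟩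
  · exact (norm_restrictV_le i hWW _).trans (H.bound t ht _ (hcl' Y hY))
  · have : TreeTN.subF i W F t Y - restrictV i W (g t) =
        restrictV i W (F t (prolongV i W Y) - g t) := by rw [map_sub]; rfl
    rw [this]
    exact (norm_restrictV_le i hWW _).trans
      (H.close t ht _ (hcl' Y hY) ((hdist Y).trans_le hR))
  · have := H.normal t ht _ (hcl p hp) ((hdist _).trans_le hR)
    dsimp only at this
    rwa [inner_prolongV, norm_prolongV i hWW] at this

theorem norm_sub_le_of_hasDerivWithinAt {E : Type*} [NormedAddCommGroup E] [NormedSpace ℝ E]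
    {y y' : ℝ → E} {t₀ t₁ C : ℝ} (hC : 0 ≤ C)
    (hy : ∀ t ∈ Icc t₀ t₁, HasDerivWithinAt y (y' t) (Icc t₀ t₁) t)
    (hb : ∀ t ∈ Icc t₀ t₁, ‖y' t‖ ≤ C) : ∀ t ∈ Icc t₀ t₁, ‖y t - y t₀‖ ≤ C * (t₁ - t₀) :=
  fun t ht => (norm_image_sub_le_of_norm_deriv_le_segment' hy
    (fun s hs => hb s (Ico_subset_Icc_self hs)) t ht).trans
      (mul_le_mul_of_nonneg_left (by linarith [ht.2]) hC)

/-! ### The linear maps that act in one step. -/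

/-- The map `Z ↦ Tenᵢ(M Matᵢ(Z) N)` on the space attached to a tree. -/
def sandwichV (i : Fin m) (M : Matrix (Idx n (c i)) (Idx n (c i)) ℝ)
    (N : Matrix (Fin (r (.node m c)) × ((j : {j // j ≠ i}) → Idx n (c j)))
      (Fin (r (.node m c)) × ((j : {j // j ≠ i}) → Idx n (c j))) ℝ) :
    V n r (.node m c) →L[ℝ] V n r (.node m c) :=
  sandwichL (γ := fun j => Idx n (c j)) i M N

/-- The Tucker product on the space attached to a tree. -/
def tuckerV (A : (j : Fin m) → Matrix (Idx n (c j)) (Idx n (c j)) ℝ) :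
    V n r (.node m c) →L[ℝ] V n r (.node m c) :=
  tuckerL (γ := fun j => Idx n (c j)) (κ := fun j => Idx n (c j)) A

/-- The Tucker product of a core, with values in the space attached to a tree. -/
def coreV (U : (j : Fin m) → Matrix (Idx n (c j)) (Fin (r (c j))) ℝ) :
    Core r c →L[ℝ] V n r (.node m c) :=
  tuckerL (γ := fun j => Idx n (c j)) (κ := fun j => Fin (r (c j))) U

/-- The map `S ↦ Ten₀((U S)ᵀ)`. -/
def expandL {a k : Type*} [Fintype a] [Fintype k] (U : Matrix a k ℝ) :
    EuclideanSpace ℝ (k × k) →L[ℝ] EuclideanSpace ℝ (k × a) :=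
  LinearMap.toContinuousLinearMap
    { toFun := fun S => ten₀ (U * mat₀ S)ᵀ
      map_add' := fun x y => mat₀_injective (by
        simp only [mat₀_add, mat₀_ten₀, Matrix.mul_add, Matrix.transpose_add])
      map_smul' := fun a x => mat₀_injective (by
        simp only [mat₀_smul, mat₀_ten₀, Matrix.mul_smul, Matrix.transpose_smul,
          RingHom.id_apply]) }

/-- The map `Z ↦ Ten₀(Mat₀(Z) P)`. -/
def mulRightL {a k : Type*} [Fintype a] [Fintype k] (P : Matrix a a ℝ) :
    EuclideanSpace ℝ (k × a) →L[ℝ] EuclideanSpace ℝ (k × a) :=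
  LinearMap.toContinuousLinearMap
    { toFun := fun Z => ten₀ (mat₀ Z * P)
      map_add' := fun x y => mat₀_injective (by
        simp only [mat₀_add, mat₀_ten₀, Matrix.add_mul])
      map_smul' := fun a x => mat₀_injective (by
        simp only [mat₀_smul, mat₀_ten₀, Matrix.smul_mul, RingHom.id_apply]) }

theorem mat₀_mulRightL {a k : Type*} [Fintype a] [Fintype k] (P : Matrix a a ℝ)
    (Z : EuclideanSpace ℝ (k × a)) : mat₀ (mulRightL P Z) = mat₀ Z * P := rfl

theorem norm_mulRightL_le {a k : Type*} [Fintype a] [Fintype k] {P : Matrix a a ℝ}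
    (hP : Pᵀ = P) (hP' : P * P = P) (Z : EuclideanSpace ℝ (k × a)) : ‖mulRightL P Z‖ ≤ ‖Z‖ := by
  apply norm_le_of_norm_sq_eq_inner
  rw [inner_eq_trace_mat₀, inner_eq_trace_mat₀, mat₀_mulRightL, Matrix.transpose_mul, hP,
    Matrix.trace_mul_comm, Matrix.mul_assoc, ← Matrix.mul_assoc P P, hP', Matrix.trace_mul_comm]

theorem expandL_neg {a k : Type*} [Fintype a] [Fintype k] (U : Matrix a k ℝ)
    (X : EuclideanSpace ℝ (k × a)) :
    expandL U (ten₀ (-(Uᵀ * (mat₀ X)ᵀ))) = -mulRightL (U * Uᵀ) X := by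
  apply mat₀_injective
  change (U * -(Uᵀ * (mat₀ X)ᵀ))ᵀ = -(mat₀ X * (U * Uᵀ))
  rw [Matrix.mul_neg, Matrix.transpose_neg, ← Matrix.mul_assoc, Matrix.transpose_mul,
    Matrix.transpose_mul, Matrix.transpose_transpose, Matrix.transpose_transpose]

theorem transpose_mul_transpose_self {a k : Type*} [Fintype a] [Fintype k] (U : Matrix a k ℝ) :
    (U * Uᵀ)ᵀ = U * Uᵀ := by
  rw [Matrix.transpose_mul, Matrix.transpose_transpose]

theorem mul_transpose_idem {a k : Type*} [Fintype a] [Fintype k] [DecidableEq k]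
    {U : Matrix a k ℝ} (hU : Uᵀ * U = 1) : U * Uᵀ * (U * Uᵀ) = U * Uᵀ := by
  rw [Matrix.mul_assoc, ← Matrix.mul_assoc Uᵀ, hU, Matrix.one_mul]

theorem one_sub_transpose {a k : Type*} [Fintype a] [Fintype k] [DecidableEq a]
    (U : Matrix a k ℝ) : (1 - U * Uᵀ)ᵀ = 1 - U * Uᵀ := by
  rw [Matrix.transpose_sub, Matrix.transpose_one, transpose_mul_transpose_self]

theorem one_sub_idem {a k : Type*} [Fintype a] [Fintype k] [DecidableEq a] [DecidableEq k]
    {U : Matrix a k ℝ} (hU : Uᵀ * U = 1) : (1 - U * Uᵀ) * (1 - U * Uᵀ) = 1 - U * Uᵀ := by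
  rw [Matrix.sub_mul, Matrix.one_mul, Matrix.mul_sub, Matrix.mul_one, mul_transpose_idem hU,
    sub_self, sub_zero]

theorem transpose_mul_one_sub {a k : Type*} [Fintype a] [Fintype k] [DecidableEq a] [DecidableEq k]
    {U : Matrix a k ℝ} (hU : Uᵀ * U = 1) : Uᵀ * (1 - U * Uᵀ) = 0 := by
  rw [Matrix.mul_sub, Matrix.mul_one, ← Matrix.mul_assoc, hU, Matrix.one_mul, sub_self]

theorem one_sub_mul_self {a k : Type*} [Fintype a] [Fintype k] [DecidableEq a] [DecidableEq k]
    {U : Matrix a k ℝ} (hU : Uᵀ * U = 1) : (1 - U * Uᵀ) * U = 0 := by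
  rw [Matrix.sub_mul, Matrix.one_mul, Matrix.mul_assoc, hU, Matrix.mul_one, sub_self]

/-- The component of the Tucker product that is not reproduced by a subflow. -/
theorem tuckerV_sub_update (i : Fin m)
    {Q : Matrix (Fin (r (.node m c)) × ((j : {j // j ≠ i}) → Fin (r (c j)))) (Fin (r (c i))) ℝ}
    (U : (j : Fin m) → Matrix (Idx n (c j)) (Fin (r (c j))) ℝ)
    {W : Matrix (Fin (r (.node m c)) × ((j : {j // j ≠ i}) → Idx n (c j))) (Fin (r (c i))) ℝ}
    (hW : W = vMat (γ := fun j => Idx n (c j)) i Q U)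
    {A : (j : Fin m) → Matrix (Idx n (c j)) (Idx n (c j)) ℝ} (hi : A i = 1)
    (hA : ∀ j, j ≠ i → A j * U j = U j) (P : Matrix (Idx n (c i)) (Idx n (c i)) ℝ)
    (Z : V n r (.node m c)) :
    tuckerV A Z - tuckerV (Function.update A i P) Z =
      prolongV i W (restrictV i W Z - mulRightL Pᵀ (restrictV i W Z)) +
        tuckerV A (sandwichV i (1 - P) (1 - W * Wᵀ) Z) := by
  have h1 : tuckerV (Function.update A i P) Z = tuckerV A (sandwichV i P 1 Z) :=
    (tucker_update (γ := fun j => Idx n (c j)) i hi P Z).symm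
  have h2 : tuckerV A (prolongV i W (restrictV i W Z - mulRightL Pᵀ (restrictV i W Z))) =
      prolongV i W (restrictV i W Z - mulRightL Pᵀ (restrictV i W Z)) := by
    rw [hW]
    exact tucker_prolongL (γ := fun j => Idx n (c j)) (κ := fun j => Fin (r (c j))) i Q U hi hA _
  rw [h1, ← map_sub, ← h2, ← map_add]
  congr 1
  -- The modes `j ≠ i` are now gone, because `A` fixes the range of the prolongation. What remains
  -- is `(1 - P) M = (1 - P) M W Wᵀ + (1 - P) M (1 - W Wᵀ)`.
  apply mat_injective (γ := fun j => Idx n (c j)) i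
  set M := mat (γ := fun j => Idx n (c j)) i Z with hM
  have h3 : mat (γ := fun j => Idx n (c j)) i (sandwichV i P 1 Z) = P * M :=
    (mat_sandwichL (γ := fun j => Idx n (c j)) i _ _ _).trans (Matrix.mul_one _)
  have h4 : mat (γ := fun j => Idx n (c j)) i (sandwichV i (1 - P) (1 - W * Wᵀ) Z) =
      (1 - P) * M * (1 - W * Wᵀ) := mat_sandwichL (γ := fun j => Idx n (c j)) i _ _ _
  have h5 : mat (γ := fun j => Idx n (c j)) i
      (prolongV i W (restrictV i W Z - mulRightL Pᵀ (restrictV i W Z))) =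
      ((M * W)ᵀ - (M * W)ᵀ * Pᵀ)ᵀ * Wᵀ :=
    mat_prolongL (γ := fun j => Idx n (c j)) i W _
  refine (congrArg (fun X => M - X) h3).trans (Eq.trans ?_ (congrArg₂ (· + ·) h5 h4).symm)
  rw [Matrix.transpose_sub, ← Matrix.transpose_mul, Matrix.transpose_transpose,
    Matrix.transpose_transpose, Matrix.mul_sub, Matrix.mul_one, Matrix.sub_mul, Matrix.sub_mul,
    Matrix.sub_mul, Matrix.one_mul]
  simp only [Matrix.mul_assoc]
  abel

/-- The recursive step on the subtree adds nearly `π(π† ΔG)`, and the backward flow of `S` removes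
nearly the part `U Uᵀ` of it. The result is the change of the projected increment when mode `i`
passes from the identity to `U Uᵀ`, up to a normal remainder. The hypothesis `hsub` is the induction
hypothesis for the subtree; the matrices `A j` stand for the projections in the other modes. To the
subtree constant `K` the flow of `S` adds `1` in the displacement and in the error, and the normal
remainder a further `1` in the error. -/
theorem Phi.local_error {i : Fin m}
    {sub : (ℝ → V n r (c i) → V n r (c i)) → TTN n r (c i) → TTN n r (c i) → Prop}
    {F : ℝ → V n r (.node m c) → V n r (.node m c)} {t₀ t₁ : ℝ} {D₀ D₁ : TTN n r (.node m c)}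
    (hΦ : Phi i sub F t₀ t₁ D₀ D₁) (ht : t₀ ≤ t₁) (hne : (manifold n r (.node m c)).Nonempty)
    (hO : D₀.Orthonormal) {g G : ℝ → V n r (.node m c)} {B η ε K : ℝ}
    (hB : 0 ≤ B) (hη : 0 ≤ η) (hε : 0 ≤ ε)
    (H : LocalHyp (.node m c) F g t₀ t₁ D₀.tensor B η ε ((K + 1) * (B * (t₁ - t₀))))
    (hG : ∀ t ∈ Icc t₀ t₁, HasDerivWithinAt G (g t) (Icc t₀ t₁) t)
    (hsub : ∀ (F' : ℝ → V n r (c i) → V n r (c i)) (g' G' : ℝ → V n r (c i))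
      (D₀' D₁' : TTN n r (c i)), sub F' D₀' D₁' → D₀'.Orthonormal →
      LocalHyp (c i) F' g' t₀ t₁ D₀'.tensor B η ε (K * (B * (t₁ - t₀))) →
      (∀ t ∈ Icc t₀ t₁, HasDerivWithinAt G' (g' t) (Icc t₀ t₁) t) →
      D₁'.Orthonormal ∧ ‖D₁'.tensor - D₀'.tensor‖ ≤ K * (B * (t₁ - t₀)) ∧
      ‖D₁'.tensor - D₀'.tensor - (G' t₁ - G' t₀)‖ ≤ K * ((t₁ - t₀) * (η + ε))) :
    D₁.Orthonormal ∧ ‖D₁.tensor - D₀.tensor‖ ≤ (K + 1) * (B * (t₁ - t₀)) ∧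
    ∀ A : (j : Fin m) → Matrix (Idx n (c j)) (Idx n (c j)) ℝ, (∀ j, (A j)ᵀ = A j) →
      (∀ j, A j * A j = A j) → A i = 1 →
      (∀ j, j ≠ i → A j * (D₀.child j).basis = (D₀.child j).basis) →
      ‖D₁.tensor - D₀.tensor - (tuckerV A (G t₁ - G t₀) - tuckerV (Function.update A i
        ((D₁.child i).basis * (D₁.child i).basisᵀ)) (G t₁ - G t₀))‖ ≤
        (K + 2) * ((t₁ - t₀) * (η + ε)) := by
  obtain ⟨hc, Q, S₀, S₁, S₂, K₁, F₁, hQS, hQ, hF₁, hsubK, hK₁, hTop, ⟨y, hy0, hy1, hy⟩, hcore⟩ := hΦ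
  set h := t₁ - t₀ with hh
  have hh0 : 0 ≤ h := sub_nonneg.2 ht
  have hD₀ : ∀ j, (D₀.child j).basisᵀ * (D₀.child j).basis = 1 ∧ (D₀.child j).Orthonormal := by
    cases D₀ with | node C D => exact hO
  set W := vMat (γ := fun j => Idx n (c j)) i Q fun j => (D₀.child j).basis with hW
  have hWW : Wᵀ * W = 1 :=
    vMat_orthonormal (γ := fun j => Idx n (c j)) i hQ fun j _ => (hD₀ j).1
  have hWcl : ∀ Y ∈ closure (manifold n r (c i)), prolongV i W Y ∈
      closure (manifold n r (.node m c)) := fun Y hY => fst_mem_closure_of_mem_normalPairs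
    (prolong_mem_closure_normalPairs hne i D₀.child hQ (fun j _ => (hD₀ j).1) hW
      (zero_mem_closure_normalPairs hY))
  have hne' := manifold_child_nonempty hne i
  -- the initial value as a prolongation
  have hY0 : D₀.tensor = prolongV i W ((D₀.child i).mulTop S₀).tensor := by
    have h1 : D₀.core = ten (γ := fun j => Fin (r (c j))) i (S₀ * Qᵀ) := by
      have := congrArg (fun M => ten (γ := fun j => Fin (r (c j))) i Mᵀ) hQS
      simpa using this
    conv_lhs => rw [← D₀.eta, h1]
    exact TTN.tensor_node_update_mulTop i Q S₀ D₀.child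
  rw [hY0] at H
  have hKR : K * (B * h) ≤ (K + 1) * (B * h) :=
    mul_le_mul_of_nonneg_right (by linarith) (mul_nonneg hB hh0)
  obtain ⟨hO₁, hd₁, he₁⟩ := hsub F₁ (fun t => restrictV i W (g t)) (fun t => restrictV i W (G t))
    _ _ hsubK (TTN.orthonormal_mulTop.2 (hD₀ i).2)
    (by
      rw [hF₁]
      exact (H.shift (Y₁ := prolongV i W ((D₀.child i).mulTop S₀).tensor) (by simpa using hKR)).subF
        i hne D₀.child hQ (fun j _ => (hD₀ j).1) hW)
    (fun t ht => (restrictV i W).hasFDerivAt.comp_hasDerivWithinAt t (hG t ht))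
  rw [hK₁, TTN.orthonormal_mulTop] at hO₁
  set U := (D₁.child i).basis with hU
  have hUU : Uᵀ * U = 1 := TTN.basis_orthonormal hO₁ hTop
  have hD₁ : ∀ j, (D₁.child j).basisᵀ * (D₁.child j).basis = 1 ∧ (D₁.child j).Orthonormal := by
    intro j
    by_cases hj : j = i
    · subst hj; exact ⟨hUU, hO₁⟩
    · rw [hc j hj]; exact hD₀ j
  -- `W` does not involve branch `i`, so the new value is a prolongation by the same `W`.
  have hW₁ : W = vMat (γ := fun j => Idx n (c j)) i Q fun j => (D₁.child j).basis :=
    vMat_congr (γ := fun j => Idx n (c j)) i Q (U := fun j => (D₀.child j).basis)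
      (U' := fun j => (D₁.child j).basis) fun j hj => by rw [hc j hj]
  have hY1 : D₁.tensor = prolongV i W ((D₁.child i).mulTop S₂).tensor := by
    conv_lhs => rw [← D₁.eta, hcore]
    rw [hW₁]
    exact TTN.tensor_node_update_mulTop i Q S₂ D₁.child
  -- the evolution of the matrix `S` in the space of the subtree
  set z : ℝ → V n r (c i) := fun t => ((D₁.child i).mulTop (mat₀ (y t))).tensor with hz
  have hzE : ∀ t, z t = expandL U (y t) := fun t => TTN.tensor_mulTop _ _
  have hz0 : z t₀ = K₁.tensor := by
    simp only [hz]; rw [hy0, hK₁, mat₀_ten₀]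
  have hz1 : z t₁ = ((D₁.child i).mulTop S₂).tensor := by
    simp only [hz]; rw [hy1, mat₀_ten₀]
  have hzcl : ∀ t, z t ∈ closure (manifold n r (c i)) := fun t => tensor_mem_closure_manifold _ hne'
  have hzd : ∀ t ∈ Icc t₀ t₁, HasDerivWithinAt z
      (-mulRightL (U * Uᵀ) (restrictV i W (F t (prolongV i W (z t))))) (Icc t₀ t₁) t := by
    intro t ht
    have h1 := (expandL U).hasFDerivAt.comp_hasDerivWithinAt t (hy t ht)
    have h2 : z = ⇑(expandL U) ∘ y := funext hzE
    rw [h2]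
    refine h1.congr_deriv ?_
    rw [← h2, hF₁]
    exact expandL_neg U _
  have hPle : ∀ Z : V n r (c i), ‖mulRightL (U * Uᵀ) Z‖ ≤ ‖Z‖ :=
    norm_mulRightL_le (transpose_mul_transpose_self U) (mul_transpose_idem hUU)
  have hzB : ∀ t ∈ Icc t₀ t₁, ‖z t - z t₀‖ ≤ B * h :=
    norm_sub_le_of_hasDerivWithinAt hB hzd fun t ht => by
      rw [norm_neg]
      exact (hPle _).trans ((norm_restrictV_le i hWW _).trans (H.bound t ht _ (hWcl _ (hzcl t))))
  have hzR : ∀ t ∈ Icc t₀ t₁, ‖z t - ((D₀.child i).mulTop S₀).tensor‖ ≤ (K + 1) * (B * h) := by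
    intro t ht
    have h1 := norm_sub_le_norm_sub_add_norm_sub (z t) (z t₀) ((D₀.child i).mulTop S₀).tensor
    have h2 := hzB t ht
    rw [hz0] at h1 h2
    linarith
  -- Adding the projected `G` cancels the main part of the backward flow: the derivative is minus a
  -- projection of `F - g`.
  have hzη : ‖(z t₁ + mulRightL (U * Uᵀ) (restrictV i W (G t₁))) -
      (z t₀ + mulRightL (U * Uᵀ) (restrictV i W (G t₀)))‖ ≤ η * h := by
    refine norm_sub_le_of_hasDerivWithinAt
      (y := fun t => z t + mulRightL (U * Uᵀ) (restrictV i W (G t))) hη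
      (fun t ht => (hzd t ht).add ((mulRightL (U * Uᵀ)).hasFDerivAt.comp_hasDerivWithinAt t
        ((restrictV i W).hasFDerivAt.comp_hasDerivWithinAt t (hG t ht)))) ?_ t₁ ⟨ht, le_rfl⟩
    intro t ht
    have h1 : -mulRightL (U * Uᵀ) (restrictV i W (F t (prolongV i W (z t)))) +
        mulRightL (U * Uᵀ) (restrictV i W (g t)) =
        -mulRightL (U * Uᵀ) (restrictV i W (F t (prolongV i W (z t)) - g t)) := by
      rw [map_sub, map_sub]; abel
    refine (congrArg norm h1).trans_le ?_
    rw [norm_neg]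
    refine (hPle _).trans ((norm_restrictV_le i hWW _).trans
      (H.close t ht _ (hWcl _ (hzcl t)) ?_))
    rw [← map_sub, norm_prolongV i hWW]
    exact hzR t ht
  have hYd : ‖D₁.tensor - D₀.tensor‖ ≤ (K + 1) * (B * h) := by
    rw [hY0, hY1, ← map_sub, norm_prolongV i hWW, ← hz1]
    exact hzR t₁ ⟨ht, le_rfl⟩
  refine ⟨?_, hYd, ?_⟩
  · cases D₁ with | node C D => exact hD₁
  intro A hA hA' hAi hAU
  rw [tuckerV_sub_update i _ hW hAi hAU, transpose_mul_transpose_self]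
  set ΔG := G t₁ - G t₀ with hΔ
  -- the part of the increment that is normal at the final value
  have hnormal : ‖sandwichV i (1 - U * Uᵀ) (1 - W * Wᵀ) ΔG‖ ≤ (η + ε) * h := by
    rw [hΔ, map_sub]
    refine norm_sub_le_of_hasDerivWithinAt
      (y := fun t => sandwichV i (1 - U * Uᵀ) (1 - W * Wᵀ) (G t)) (add_nonneg hη hε)
      (fun t ht => (sandwichV i (1 - U * Uᵀ) (1 - W * Wᵀ)).hasFDerivAt.comp_hasDerivWithinAt t
        (hG t ht)) ?_ t₁ ⟨ht, le_rfl⟩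
    intro t ht
    have hle : ∀ Z : V n r (.node m c), ‖sandwichV i (1 - U * Uᵀ) (1 - W * Wᵀ) Z‖ ≤ ‖Z‖ :=
      norm_sandwichL_le (γ := fun j => Idx n (c j)) i (one_sub_transpose U) (one_sub_idem hUU)
        (one_sub_transpose W) (one_sub_idem hWW)
    have h1 := H.close t ht D₁.tensor (tensor_mem_closure_manifold _ hne) (by rw [← hY0]; exact hYd)
    -- The projected vector `Z` is itself the test vector: it is a limit of normal vectors at
    -- `D₁.tensor`, and `⟪Z, Z⟫ = ⟪Z, F⟫ ≤ ε ‖Z‖`.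
    have h2 : ‖sandwichV i (1 - U * Uᵀ) (1 - W * Wᵀ) (F t D₁.tensor)‖ ≤ ε := by
      set Z := sandwichV i (1 - U * Uᵀ) (1 - W * Wᵀ) (F t D₁.tensor) with hZ
      have hmZ : mat (γ := fun j => Idx n (c j)) i Z = (1 - U * Uᵀ) *
          mat (γ := fun j => Idx n (c j)) i (F t D₁.tensor) * (1 - W * Wᵀ) :=
        mat_sandwichL (γ := fun j => Idx n (c j)) i _ _ _
      have h3 := H.normal t ht _ (mem_closure_normalPairs_of_mul_eq_zero hne i D₁.child S₂ hQ
        (fun j => (hD₁ j).1) hW₁ (Z := Z)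
        (by
          rw [hmZ, Matrix.mul_assoc (1 - U * Uᵀ), ← Matrix.mul_assoc]
          exact (congrArg (· * _) (transpose_mul_one_sub hUU)).trans (Matrix.zero_mul _))
        (by rw [hmZ, Matrix.mul_assoc, one_sub_mul_self hWW, Matrix.mul_zero]))
        (by dsimp only; rw [← hY1, ← hY0]; exact hYd)
      dsimp only at h3
      rw [← hY1] at h3
      have h4 : ⟪Z, Z⟫ = ⟪Z, F t D₁.tensor⟫ :=
        sandwichL_self_inner (γ := fun j => Idx n (c j)) i (one_sub_transpose U) (one_sub_idem hUU)
          (one_sub_transpose W) (one_sub_idem hWW) _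
      rw [← h4, real_inner_self_eq_norm_mul_norm] at h3
      rcases (norm_nonneg Z).eq_or_lt with h0 | h0
      · rw [← h0]; exact hε
      · exact le_of_mul_le_mul_right h3 h0
    have h5 : sandwichV i (1 - U * Uᵀ) (1 - W * Wᵀ) (g t) =
        sandwichV i (1 - U * Uᵀ) (1 - W * Wᵀ) (F t D₁.tensor) -
        sandwichV i (1 - U * Uᵀ) (1 - W * Wᵀ) (F t D₁.tensor - g t) := by
      rw [map_sub]; abel
    refine (congrArg norm h5).trans_le ((norm_sub_le _ _).trans ?_)
    linarith [hle (F t D₁.tensor - g t)]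
  have htk : ‖tuckerV A (sandwichV i (1 - U * Uᵀ) (1 - W * Wᵀ) ΔG)‖ ≤ (η + ε) * h :=
    (norm_tucker_le (γ := fun j => Idx n (c j)) hA hA' _).trans hnormal
  -- Three sources of error: the flow of `S` (`η h`), the recursive step (`K h (η + ε)`) and the
  -- normal remainder (`(η + ε) h`).
  have hsplit : D₁.tensor - D₀.tensor -
      (prolongV i W (restrictV i W ΔG - mulRightL (U * Uᵀ) (restrictV i W ΔG)) +
        tuckerV A (sandwichV i (1 - U * Uᵀ) (1 - W * Wᵀ) ΔG)) =
      prolongV i W (((z t₁ + mulRightL (U * Uᵀ) (restrictV i W (G t₁))) -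
        (z t₀ + mulRightL (U * Uᵀ) (restrictV i W (G t₀)))) +
        (K₁.tensor - ((D₀.child i).mulTop S₀).tensor -
          (restrictV i W (G t₁) - restrictV i W (G t₀)))) -
        tuckerV A (sandwichV i (1 - U * Uᵀ) (1 - W * Wᵀ) ΔG) := by
    rw [hY0, hY1, hz0, hz1, hΔ]
    simp only [map_sub, map_add]
    abel
  rw [hsplit]
  refine (norm_sub_le _ _).trans ?_
  rw [norm_prolongV i hWW]
  have h6 := norm_add_le ((z t₁ + mulRightL (U * Uᵀ) (restrictV i W (G t₁))) -
        (z t₀ + mulRightL (U * Uᵀ) (restrictV i W (G t₀))))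
        (K₁.tensor - ((D₀.child i).mulTop S₀).tensor -
          (restrictV i W (G t₁) - restrictV i W (G t₀)))
  nlinarith [mul_nonneg hh0 hε]

/-- With orthonormal bases, the flow of the core becomes `ż = T F(t, z)` for the represented tensor,
where `T` is the orthogonal projection with `U_j U_jᵀ` in every mode. Comparison with `T G` costs
only `η`. -/
theorem Psi.local_error {F : ℝ → V n r (.node m c) → V n r (.node m c)} {t₀ t₁ : ℝ}
    {D₀ D₁ : TTN n r (.node m c)} (hΨ : Psi F t₀ t₁ D₀ D₁) (ht : t₀ ≤ t₁)
    (hne : (manifold n r (.node m c)).Nonempty) (hO : D₀.Orthonormal)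
    {g G : ℝ → V n r (.node m c)} {B η ε : ℝ} (hB : 0 ≤ B) (hη : 0 ≤ η)
    (H : LocalHyp (.node m c) F g t₀ t₁ D₀.tensor B η ε (B * (t₁ - t₀)))
    (hG : ∀ t ∈ Icc t₀ t₁, HasDerivWithinAt G (g t) (Icc t₀ t₁) t) :
    D₁.Orthonormal ∧ ‖D₁.tensor - D₀.tensor‖ ≤ B * (t₁ - t₀) ∧
      ‖D₁.tensor - D₀.tensor - tuckerV (fun j => (D₀.child j).basis * (D₀.child j).basisᵀ)
        (G t₁ - G t₀)‖ ≤ η * (t₁ - t₀) := by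
  obtain ⟨hc, y, hy0, hy1, hy⟩ := hΨ
  have hD₀ : ∀ j, (D₀.child j).basisᵀ * (D₀.child j).basis = 1 ∧ (D₀.child j).Orthonormal := by
    cases D₀ with | node C D => exact hO
  set U : (j : Fin m) → Matrix (Idx n (c j)) (Fin (r (c j))) ℝ := fun j => (D₀.child j).basis
    with hU
  set T : V n r (.node m c) →L[ℝ] V n r (.node m c) := tuckerV fun j => U j * (U j)ᵀ with hT
  set z : ℝ → V n r (.node m c) := fun t => (TTN.node (y t) D₀.child).tensor with hz
  have hz0 : z t₀ = D₀.tensor := by simp only [hz]; rw [hy0, D₀.eta]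
  have hz1 : z t₁ = D₁.tensor := by simp only [hz]; rw [hy1, ← hc, D₁.eta]
  have hzcl : ∀ t, z t ∈ closure (manifold n r (.node m c)) :=
    fun t => tensor_mem_closure_manifold _ hne
  have hzd : ∀ t ∈ Icc t₀ t₁, HasDerivWithinAt z (T (F t (z t))) (Icc t₀ t₁) t := by
    intro t ht
    have h1 := (coreV (r := r) U).hasFDerivAt.comp_hasDerivWithinAt t (hy t ht)
    refine h1.congr_deriv ?_
    exact tucker_tucker (κ := fun j => Idx n (c j)) (γ := fun j => Fin (r (c j)))
      (μ := fun j => Idx n (c j)) (F t (z t)) (fun j => (U j)ᵀ) U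
  have hTle : ∀ Z, ‖T Z‖ ≤ ‖Z‖ := fun Z => norm_tucker_le (γ := fun j => Idx n (c j))
    (fun j => transpose_mul_transpose_self (U j)) (fun j => mul_transpose_idem (hD₀ j).1) Z
  have hzB : ∀ t ∈ Icc t₀ t₁, ‖z t - z t₀‖ ≤ B * (t₁ - t₀) :=
    norm_sub_le_of_hasDerivWithinAt hB hzd fun t ht =>
      (hTle _).trans (H.bound t ht _ (hzcl t))
  refine ⟨?_, ?_, ?_⟩
  · rw [← D₁.eta, hc]; exact hD₀
  · rw [← hz0, ← hz1]; exact hzB t₁ ⟨ht, le_rfl⟩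
  · have h1 : D₁.tensor - D₀.tensor - T (G t₁ - G t₀) =
        (z t₁ - T (G t₁)) - (z t₀ - T (G t₀)) := by
      rw [hz0, hz1, map_sub]; abel
    rw [h1]
    refine norm_sub_le_of_hasDerivWithinAt (y := fun t => z t - T (G t)) hη
      (fun t ht => (hzd t ht).sub (T.hasFDerivAt.comp_hasDerivWithinAt t (hG t ht))) ?_ t₁
      ⟨ht, le_rfl⟩
    intro t ht
    have h2 : T (F t (z t)) - T (g t) = T (F t (z t) - g t) := (map_sub T _ _).symm
    refine (congrArg norm h2).trans_le ((hTle _).trans (H.close t ht _ (hzcl t) ?_))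
    rw [← hz0]
    exact hzB t ht

end Local

/-! ### The error of one recursive step. -/

section Local

variable {𝓛 : Type*} {n : 𝓛 → ℕ} {r : OTree 𝓛 → ℕ}

/-- Induction on the tree. At a node the contributions of the subflows telescope to `ΔG - T ΔG`, and
the flow of the core adds the missing `T ΔG`. -/
theorem step_local_error (τ : OTree 𝓛) : ∀ {F : ℝ → V n r τ → V n r τ} {g G : ℝ → V n r τ}
    {t₀ t₁ B η ε : ℝ} {D₀ D₁ : TTN n r τ}, Step τ F t₀ t₁ D₀ D₁ → t₀ ≤ t₁ →
    (manifold n r τ).Nonempty → D₀.Orthonormal → 0 ≤ B → 0 ≤ η → 0 ≤ ε →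
    LocalHyp τ F g t₀ t₁ D₀.tensor B η ε (cst τ * (B * (t₁ - t₀))) →
    (∀ t ∈ Icc t₀ t₁, HasDerivWithinAt G (g t) (Icc t₀ t₁) t) →
    D₁.Orthonormal ∧ ‖D₁.tensor - D₀.tensor‖ ≤ cst τ * (B * (t₁ - t₀)) ∧
      ‖D₁.tensor - D₀.tensor - (G t₁ - G t₀)‖ ≤ cst τ * ((t₁ - t₀) * (η + ε)) := by
  induction τ with
  | leaf l =>
    intro F g G t₀ t₁ B η ε D₀ D₁ hS ht hne hO hB hη hε H hG
    obtain ⟨y, hy0, hy1, hy⟩ := hS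
    simp only [cst, one_mul] at H ⊢
    -- At a leaf every element of the space is the tensor of a network, so there is no normal
    -- remainder.
    have hcl : ∀ t, y t ∈ closure (manifold n r (.leaf l)) := fun t =>
      tensor_mem_closure_manifold (TTN.leaf (mat₀ (y t))ᵀ) hne
    have hyB : ∀ t ∈ Icc t₀ t₁, ‖y t - y t₀‖ ≤ B * (t₁ - t₀) :=
      norm_sub_le_of_hasDerivWithinAt hB hy fun t ht => H.bound t ht _ (hcl t)
    refine ⟨?_, ?_, ?_⟩
    · cases D₁; trivial
    · rw [← hy0, ← hy1]; exact hyB t₁ ⟨ht, le_rfl⟩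
    · have h1 : D₁.tensor - D₀.tensor - (G t₁ - G t₀) = (y t₁ - G t₁) - (y t₀ - G t₀) := by
        rw [hy0, hy1]; abel
      rw [h1]
      refine (norm_sub_le_of_hasDerivWithinAt (y := fun t => y t - G t) hη
        (fun t ht => (hy t ht).sub (hG t ht)) (fun t ht => H.close t ht _ (hcl t) ?_) t₁
        ⟨ht, le_rfl⟩).trans ?_
      · rw [← hy0]; exact hyB t ht
      · nlinarith [mul_nonneg (sub_nonneg.2 ht) hε]
  | node m c ih =>
    intro F g G t₀ t₁ B η ε D₀ D₁ hS ht hne hO hB hη hε H hG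
    obtain ⟨E, hE0, hΦ, hΨ⟩ := hS
    have hh : 0 ≤ t₁ - t₀ := sub_nonneg.2 ht
    set b := B * (t₁ - t₀) with hb
    set e := (t₁ - t₀) * (η + ε) with he
    have hb0 : 0 ≤ b := mul_nonneg hB hh
    have he0 : 0 ≤ e := mul_nonneg hh (add_nonneg hη hε)
    -- The part of `cst` used by the first `k` subflows. At least `1` is always left for the flow of
    -- the core.
    set s : ℕ → ℝ := fun k => ∑ j : Fin m, if j.val < k then cst (c j) + 2 else 0 with hs
    have hs1 : ∀ i : Fin m, s (i.val + 1) = s i.val + (cst (c i) + 2) := by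
      intro i
      have h1 : ∀ j : Fin m, (if j.val < i.val + 1 then cst (c j) + 2 else 0) =
          (if j.val < i.val then cst (c j) + 2 else 0) +
            (if j = i then cst (c j) + 2 else 0) := by
        intro j
        rcases lt_trichotomy j.val i.val with h | h | h
        · have : j ≠ i := fun h' => by rw [h'] at h; exact lt_irrefl _ h
          simp [h, this, h.trans (Nat.lt_succ_self _)]
        · have : j = i := Fin.ext h
          subst this; simp
        · have h2 : j ≠ i := fun h' => by rw [h'] at h; exact lt_irrefl _ h
          have h3 : ¬ j.val < i.val + 1 := by omega
          have h4 : ¬ j.val < i.val := by omega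
          simp [h2, h3, h4]
      simp only [hs, h1, Finset.sum_add_distrib, Finset.sum_ite_eq', Finset.mem_univ, if_true]
    have hsle : ∀ k, s k + 1 ≤ cst (.node m c) := by
      intro k
      rw [cst]
      refine add_le_add (Finset.sum_le_sum fun j _ => ?_) le_rfl
      split_ifs
      · exact le_rfl
      · linarith [cst_nonneg (c j)]
    set ΔG := G t₁ - G t₀ with hΔ
    -- Projections onto the new bases in the modes already treated, the identity in the others. Thus
    -- `A 0` is the identity, and `A (Fin.last m)` is the projection occurring in the flow of the
    -- core.
    set A : Fin (m + 1) → (j : Fin m) → Matrix (Idx n (c j)) (Idx n (c j)) ℝ := fun k j =>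
      if j.val < k.val then ((E k).child j).basis * ((E k).child j).basisᵀ else 1 with hA
    have inv : ∀ k : Fin (m + 1), (E k).Orthonormal ∧ ‖(E k).tensor - D₀.tensor‖ ≤ s k.val * b ∧
        ‖(E k).tensor - D₀.tensor - (ΔG - tuckerV (A k) ΔG)‖ ≤ s k.val * e := by
      intro k
      induction k using Fin.induction with
      | zero =>
        have hA0 : A 0 = fun j => 1 := by
          funext j; simp [hA]
        have h1 : tuckerV (A 0) ΔG = ΔG := by
          rw [hA0]
          exact tucker_one (κ := fun j => Idx n (c j)) ΔG
        rw [h1, hE0, sub_self, sub_self, sub_self, norm_zero]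
        simp [hs, hO]
      | succ i ihk =>
        obtain ⟨h1, h2, h3⟩ := ihk
        have hs1i := hs1 i
        rw [Fin.val_castSucc] at h2 h3
        rw [Fin.val_succ, hs1i]
        have hsi := hsle (i.val + 1)
        rw [hs1i] at hsi
        have hci := cst_nonneg (c i)
        have hch := (hΦ i).1
        obtain ⟨h4, h5, h6⟩ := Phi.local_error (hΦ i) ht hne h1 hB hη hε
          (H.shift (R' := (cst (c i) + 1) * b) (by
            have := mul_le_mul_of_nonneg_right hsi hb0
            nlinarith)) hG
          (fun F' g' G' D₀' D₁' hst hO' H' hG' =>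
            ih i hst ht (manifold_child_nonempty hne i) hO' hB hη hε H' hG')
        have hon : ∀ j, ((E i.castSucc).child j).basisᵀ * ((E i.castSucc).child j).basis = 1 := by
          generalize E i.castSucc = X at h1
          cases X with | node C D => exact fun j => (h1 j).1
        have h7 := h6 (A i.castSucc) (fun j => by
            simp only [hA]
            split_ifs
            · exact transpose_mul_transpose_self _
            · exact Matrix.transpose_one)
          (fun j => by
            simp only [hA]
            split_ifs
            · exact mul_transpose_idem (hon j)
            · exact Matrix.one_mul _)
          (by simp [hA])
          (fun j _ => by
            simp only [hA]
            split_ifs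
            · rw [Matrix.mul_assoc, hon j, Matrix.mul_one]
            · exact Matrix.one_mul _)
        have hAs : Function.update (A i.castSucc) i
            (((E i.succ).child i).basis * ((E i.succ).child i).basisᵀ) = A i.succ := by
          funext j
          by_cases hj : j = i
          · subst hj; simp [hA]
          · rw [Function.update_of_ne hj]
            have hj' : j.val ≠ i.val := fun h => hj (Fin.ext h)
            have hiff : (j.val < i.castSucc.val) ↔ (j.val < i.succ.val) := by
              rw [Fin.val_castSucc, Fin.val_succ]; omega
            simp only [hA, hiff, hch j hj]
        rw [hAs] at h7
        refine ⟨h4, ?_, ?_⟩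
        · have := norm_sub_le_norm_sub_add_norm_sub (E i.succ).tensor (E i.castSucc).tensor
            D₀.tensor
          nlinarith
        · have h8 : (E i.succ).tensor - D₀.tensor - (ΔG - tuckerV (A i.succ) ΔG) =
              ((E i.succ).tensor - (E i.castSucc).tensor -
                (tuckerV (A i.castSucc) ΔG - tuckerV (A i.succ) ΔG)) +
              ((E i.castSucc).tensor - D₀.tensor - (ΔG - tuckerV (A i.castSucc) ΔG)) := by abel
          rw [h8]
          refine (norm_add_le _ _).trans ?_
          linarith
    obtain ⟨h1, h2, h3⟩ := inv (Fin.last m)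
    rw [Fin.val_last] at h2 h3
    have hsm := hsle m
    obtain ⟨h4, h5, h6⟩ := Psi.local_error hΨ ht hne h1 hB hη
      (H.shift (R' := b) (by
        have := mul_le_mul_of_nonneg_right hsm hb0
        linarith)) hG
    have hAm : A (Fin.last m) = fun j =>
        ((E (Fin.last m)).child j).basis * ((E (Fin.last m)).child j).basisᵀ := by
      funext j
      simp only [hA, Fin.val_last, j.2, if_true]
    rw [hAm] at h3
    refine ⟨h4, ?_, ?_⟩
    · have := norm_sub_le_norm_sub_add_norm_sub D₁.tensor (E (Fin.last m)).tensor D₀.tensor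
      have := mul_le_mul_of_nonneg_right hsm hb0
      linarith
    · have h8 : D₁.tensor - D₀.tensor - ΔG = (D₁.tensor - (E (Fin.last m)).tensor -
          tuckerV (fun j => ((E (Fin.last m)).child j).basis *
            ((E (Fin.last m)).child j).basisᵀ) ΔG) +
          ((E (Fin.last m)).tensor - D₀.tensor - (ΔG - tuckerV (fun j =>
            ((E (Fin.last m)).child j).basis * ((E (Fin.last m)).child j).basisᵀ) ΔG)) := by abel
      rw [h8]
      refine (norm_add_le _ _).trans ?_
      have := mul_le_mul_of_nonneg_right hsm he0
      have h9 : η * (t₁ - t₀) ≤ e := by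
        rw [he]; nlinarith [mul_nonneg hh hε]
      linarith

end Local

/-! ### The global error -/

section Global

theorem exp_sub_one_le {y : ℝ} : Real.exp y - 1 ≤ y * Real.exp y := by
  have h := Real.one_sub_le_exp_neg y
  have h1 : Real.exp (-y) * Real.exp y = 1 := by rw [← Real.exp_add]; simp
  nlinarith [Real.exp_pos y]

/-- A form of the bound without division by `K`, so that the case `K = 0` needs no separate
treatment later. -/
theorem gronwallBound_zero_le {K ε x : ℝ} (hK : 0 ≤ K) (hε : 0 ≤ ε) :
    gronwallBound 0 K ε x ≤ ε * x * Real.exp (K * x) := by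
  by_cases h : K = 0
  · subst h
    rw [gronwallBound_K0]; simp
  · rw [gronwallBound_of_K_ne_0 h]
    dsimp only
    rw [zero_mul, zero_add]
    calc ε / K * (Real.exp (K * x) - 1) ≤ ε / K * (K * x * Real.exp (K * x)) := by
          gcongr; exact exp_sub_one_le
      _ = ε * x * Real.exp (K * x) := by field_simp

/-- Growth of the solution of a differential equation with a right-hand side of linear growth. -/
theorem norm_sub_le_of_linear_growth {E : Type*} [NormedAddCommGroup E] [NormedSpace ℝ E]
    {y y' : ℝ → E} {t₀ t₁ K ε : ℝ} (hK : 0 ≤ K) (hε : 0 ≤ ε)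
    (hy : ∀ t ∈ Icc t₀ t₁, HasDerivWithinAt y (y' t) (Icc t₀ t₁) t)
    (hb : ∀ t ∈ Icc t₀ t₁, ‖y' t‖ ≤ K * ‖y t - y t₀‖ + ε) :
    ∀ t ∈ Icc t₀ t₁, ‖y t - y t₀‖ ≤ ε * (t - t₀) * Real.exp (K * (t - t₀)) := by
  intro t ht
  have := norm_le_gronwallBound_of_norm_deriv_right_le (f := fun t => y t - y t₀) (f' := y')
    (δ := 0) (K := K) (ε := ε) (a := t₀) (b := t₁)
    (ContinuousOn.sub (fun t ht => (hy t ht).continuousWithinAt) continuousOn_const)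
    (fun s hs => ((hy s (Ico_subset_Icc_self hs)).mono_of_mem_nhdsWithin
      (Icc_mem_nhdsGE_of_mem hs)).sub_const _) (by simp)
    (fun s hs => hb s (Ico_subset_Icc_self hs)) t ht
  exact this.trans (gronwallBound_zero_le hK hε)

/-- Induction step for the error recursion. It rests on `1 + a h ≤ exp (a h)`, with the new term `h
b` majorized by the full exponential. -/
theorem discrete_gronwall_step {x x' a b h δ : ℝ} {k : ℕ} (ha : 0 ≤ a) (hb : 0 ≤ b) (hh : 0 ≤ h)
    (hx0 : 0 ≤ x) (hx : x ≤ Real.exp (a * (k * h)) * (δ + k * h * b)) (hx' : x' ≤ x * (1 + a * h) + h * b) :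
    x' ≤ Real.exp (a * ((k + 1) * h)) * (δ + (k + 1) * h * b) := by
  have h1 : 1 + a * h ≤ Real.exp (a * h) := by linarith [Real.add_one_le_exp (a * h)]
  have h2 : Real.exp (a * ((k + 1) * h)) = Real.exp (a * (k * h)) * Real.exp (a * h) := by
    rw [← Real.exp_add]; ring_nf
  have hah : 0 ≤ a * h := mul_nonneg ha hh
  have h3 : 1 ≤ Real.exp (a * ((k + 1) * h)) := Real.one_le_exp (by positivity)
  calc x' ≤ x * (1 + a * h) + h * b := hx'
    _ ≤ Real.exp (a * (k * h)) * (δ + k * h * b) * Real.exp (a * h) +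
        Real.exp (a * ((k + 1) * h)) * (h * b) := by
        refine add_le_add ?_ ?_
        · exact mul_le_mul hx h1 (by linarith) (hx0.trans hx)
        · exact le_mul_of_one_le_left (mul_nonneg hh hb) h3
    _ = _ := by rw [h2]; ring

variable {𝓛 : Type*} {n : 𝓛 → ℕ} {r : OTree 𝓛 → ℕ} {τ : OTree 𝓛}

/-- A normal vector annihilates the projection onto the tangent space, so only the residual
contributes. Unlike the projection, the resulting inequality is stable under limits of the pair. -/
theorem inner_le_of_mem_normalPairs {p : V n r τ × V n r τ} (hp : p ∈ normalPairs n r τ)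
    {X : V n r τ} {ε : ℝ}
    (h : ‖X - (tangent (manifold n r τ) p.1).starProjection X‖ ≤ ε) : ⟪p.2, X⟫ ≤ ε * ‖p.2‖ := by
  have h1 : tangent (manifold n r τ) p.1 ≤ LinearMap.ker (innerSL ℝ p.2).toLinearMap := by
    refine Submodule.span_le.2 ?_
    rintro v ⟨x, hx, hx0, hv⟩
    exact hp.2 x v hx hx0 hv
  have h2 : ⟪p.2, (tangent (manifold n r τ) p.1).starProjection X⟫ = 0 :=
    h1 (Submodule.starProjection_apply_mem _ X)
  have h3 : ⟪p.2, X⟫ = ⟪p.2, X - (tangent (manifold n r τ) p.1).starProjection X⟫ := by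
    rw [inner_sub_right, h2, sub_zero]
  rw [h3, mul_comm]
  exact (real_inner_le_norm _ _).trans (mul_le_mul_of_nonneg_left h (norm_nonneg _))

theorem tendsto_of_lipschitz {E : Type*} [NormedAddCommGroup E] {S : Set E} {f : E → E} {L : ℝ}
    (hf : ∀ Y ∈ S, ∀ Z ∈ S, ‖f Y - f Z‖ ≤ L * ‖Y - Z‖) {u : ℕ → E} {Y : E} (hu : ∀ j, u j ∈ S)
    (hY : Y ∈ S) (h : Tendsto u atTop (𝓝 Y)) : Tendsto (fun j => f (u j)) atTop (𝓝 (f Y)) := by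
  rw [tendsto_iff_norm_sub_tendsto_zero] at h ⊢
  refine squeeze_zero (fun _ => norm_nonneg _) (fun j => hf _ (hu j) _ hY) ?_
  simpa using h.const_mul L

/-- The assumptions on the right-hand side over one time step, near a point of the closed
manifold. -/
theorem localHyp_of_assumptions {F : ℝ → V n r τ → V n r τ} {g : ℝ → V n r τ}
    {t₀ t₁ L B ε ρ η R : ℝ} {Y₀ : V n r τ}
    (hL : ∀ t ∈ Icc t₀ t₁, ∀ Y ∈ closure (manifold n r τ), ∀ Z ∈ closure (manifold n r τ),
      ‖F t Y - F t Z‖ ≤ L * ‖Y - Z‖)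
    (hB : ∀ t ∈ Icc t₀ t₁, ∀ Y ∈ manifold n r τ, ‖F t Y‖ ≤ B)
    (hε : ∀ t ∈ Icc t₀ t₁, ∀ Y ∈ manifold n r τ, ‖Y‖ ≤ ρ →
      ‖F t Y - (tangent (manifold n r τ) Y).starProjection (F t Y)‖ ≤ ε)
    (hη : ∀ t ∈ Icc t₀ t₁, ∀ Y ∈ closure (manifold n r τ), ‖Y - Y₀‖ ≤ R → ‖F t Y - g t‖ ≤ η)
    (hR : ‖Y₀‖ + R < ρ) : LocalHyp τ F g t₀ t₁ Y₀ B η ε R := by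
  refine ⟨fun t ht Y hY => ?_, hη, fun t ht p hp hpR => ?_⟩
  · obtain ⟨u, hu, hu'⟩ := mem_closure_iff_seq_limit.1 hY
    exact le_of_tendsto (tendsto_of_lipschitz (hL t ht) (fun j => subset_closure (hu j)) hY hu').norm
      (Eventually.of_forall fun j => hB t ht _ (hu j))
  · obtain ⟨u, hu, hu'⟩ := mem_closure_iff_seq_limit.1 hp
    have h1 : Tendsto (fun j => (u j).1) atTop (𝓝 p.1) := (continuous_fst.tendsto p).comp hu'
    have h2 : Tendsto (fun j => (u j).2) atTop (𝓝 p.2) := (continuous_snd.tendsto p).comp hu'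
    have h3 := tendsto_of_lipschitz (hL t ht) (fun j => subset_closure (hu j).1)
      (fst_mem_closure_of_mem_normalPairs hp) h1
    -- The strict inequality `hR` lets the approximating points lie in the ball of radius `ρ`, where
    -- near tangency is assumed.
    have h4 : ∀ᶠ j in atTop, ‖(u j).1‖ < ρ := by
      refine h1.norm.eventually_lt_const ?_
      have := norm_sub_norm_le p.1 Y₀
      linarith
    refine le_of_tendsto_of_tendsto (h2.inner h3) (h2.norm.const_mul ε) ?_
    filter_upwards [h4] with j hj
    exact inner_le_of_mem_normalPairs (hu j) (hε t ht _ (hu j).1 hj.le)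

end Global

end TreeTN

end

theorem theorem6p1 {𝓛 : Type*} (τ : OTree 𝓛) (hτ : τ.IsValid) (L B T : ℝ) :
    ∃ c₀ c₁ c₂ : ℝ,
      ∀ (n : 𝓛 → ℕ) (r : OTree 𝓛 → ℕ), r τ = 1 →
      ∀ (F : ℝ → V n r τ → V n r τ) (A : ℝ → V n r τ) (ε δ ρ α h : ℝ),
      -- the exact solution, with a bound that is strictly smaller than `ρ`
      (∀ t ∈ Set.Icc 0 T, HasDerivWithinAt A (F t (A t)) (Set.Icc 0 T) t) →
      (∀ t ∈ Set.Icc 0 T, ‖A t‖ ≤ α) → α < ρ →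
      -- Lipschitz condition, bound, and tangency up to `ε`
      (∀ t ∈ Set.Icc 0 T, ∀ Y ∈ closure (manifold n r τ) ∪ {A t},
        ∀ Z ∈ closure (manifold n r τ) ∪ {A t}, ‖F t Y - F t Z‖ ≤ L * ‖Y - Z‖) →
      (∀ t ∈ Set.Icc 0 T, ∀ Y ∈ manifold n r τ, ‖F t Y‖ ≤ B) →
      0 ≤ ε →
      (∀ t ∈ Set.Icc 0 T, ∀ Y ∈ manifold n r τ, ‖Y‖ ≤ ρ →
        ‖F t Y - (tangent (manifold n r τ) Y).starProjection (F t Y)‖ ≤ ε) →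
      0 < h →
      -- smallness: the error bound keeps the numerical solution in the ball of radius `ρ`
      α + (c₀ * δ + c₁ * ε + c₂ * h) ≤ ρ →
      -- `N` steps of the integrator with step size `h`
      ∀ (N : ℕ) (D : ℕ → TTN n r τ), N * h ≤ T →
        (D 0).FullRank → (D 0).Orthonormal → ‖(D 0).tensor - A 0‖ ≤ δ →
        (∀ k < N, Step τ F (k * h) ((k + 1) * h) (D k) (D (k + 1))) →
        ‖(D N).tensor - A (N * h)‖ ≤ c₀ * δ + c₁ * ε + c₂ * h := by
  set K := cst τ with hKdef
  have hK : 0 ≤ K := cst_nonneg τ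
  -- Neither `L` nor `B` is assumed nonnegative; absolute values preserve both hypotheses.
  set l := |L| with hl
  set b := |B| with hb
  have hl0 : 0 ≤ l := abs_nonneg L
  have hb0 : 0 ≤ b := abs_nonneg B
  set X₁ := Real.exp (l * T) with hX₁
  have hX₁0 : 0 ≤ X₁ := (Real.exp_pos _).le
  -- `a₁` and `a₂` are chosen so that `η ≤ a₁ h + a₂ e` in each step, and `X₁` bounds the Gronwall
  -- factor for the exact solution. The error recursion is then `e' ≤ (1 + K a₂ h) e + h K (a₁ h +
  -- ε)`, and `X` is its growth factor over `[0, T]`.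
  set a₁ := l * (K * b + b * X₁) with ha₁
  set a₂ := l * (1 + l * T * X₁) with ha₂
  set X := Real.exp (K * a₂ * T) with hX
  have hX0 : 0 ≤ X := (Real.exp_pos _).le
  -- In `c₂` the first term is the accumulated error, `K * b` covers the radius reached within one
  -- step, and `1` makes the total strictly smaller than `ρ`, since `h > 0`.
  refine ⟨X, X * T * K, X * T * K * a₁ + K * b + 1, ?_⟩
  intro n r _ F A ε δ ρ α h hA hα _ hLip hB hε htan hh hρ N D hNT hFR hO hδ hstep
  have hT : 0 ≤ T := le_trans (by positivity) hNT
  have hne : (manifold n r τ).Nonempty := ⟨_, D 0, hFR, hO, rfl⟩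
  have ha₁0 : 0 ≤ a₁ := by positivity
  have ha₂0 : 0 ≤ a₂ := by positivity
  have hδ0 : 0 ≤ δ := (norm_nonneg _).trans hδ
  have hLip' : ∀ t ∈ Set.Icc 0 T, ∀ Y ∈ closure (manifold n r τ) ∪ {A t},
      ∀ Z ∈ closure (manifold n r τ) ∪ {A t}, ‖F t Y - F t Z‖ ≤ l * ‖Y - Z‖ :=
    fun t ht Y hY Z hZ => (hLip t ht Y hY Z hZ).trans
      (mul_le_mul_of_nonneg_right (le_abs_self L) (norm_nonneg _))
  have hB' : ∀ t ∈ Set.Icc 0 T, ∀ Y ∈ manifold n r τ, ‖F t Y‖ ≤ b :=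
    fun t ht Y hY => (hB t ht Y hY).trans (le_abs_self B)
  -- Only orthonormality is propagated, not full rank: the iterates are merely known to lie in the
  -- closure of the manifold.
  have main : ∀ k ≤ N, (D k).Orthonormal ∧ ‖(D k).tensor - A (k * h)‖ ≤
      Real.exp (K * a₂ * (k * h)) * (δ + k * h * (K * (a₁ * h + ε))) := by
    intro k
    induction k with
    | zero => intro _; simpa using ⟨hO, hδ⟩
    | succ k ih =>
      intro hk
      obtain ⟨hOk, hek⟩ := ih (by omega)
      set t₀ : ℝ := k * h with ht₀
      set t₁ : ℝ := (k + 1) * h with ht₁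
      have hkT : t₁ ≤ T := by
        refine le_trans ?_ hNT
        have : ((k : ℝ) + 1) ≤ N := by exact_mod_cast hk
        exact mul_le_mul_of_nonneg_right this hh.le
      have ht₀0 : 0 ≤ t₀ := by positivity
      have ht : t₁ - t₀ = h := by rw [ht₀, ht₁]; ring
      have ht' : t₀ ≤ t₁ := by linarith
      have hhT : h ≤ T := by linarith
      have hsub : Icc t₀ t₁ ⊆ Icc 0 T := Icc_subset_Icc ht₀0 hkT
      have hA' : ∀ t ∈ Icc t₀ t₁, HasDerivWithinAt A (F t (A t)) (Icc t₀ t₁) t :=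
        fun t ht => (hA t (hsub ht)).mono hsub
      set e := ‖(D k).tensor - A t₀‖ with he
      have he0 : 0 ≤ e := norm_nonneg _
      have hcl := tensor_mem_closure_manifold (D k) hne
      have hL1 : ∀ t ∈ Icc t₀ t₁, ∀ Y ∈ closure (manifold n r τ), ‖F t Y - F t (A t)‖ ≤
          l * ‖Y - A t‖ := fun t ht Y hY => hLip' t (hsub ht) Y (Or.inl hY) _ (Or.inr rfl)
      -- the bound for the right-hand side extends to the closure
      have hBcl : ∀ t ∈ Icc t₀ t₁, ‖F t (D k).tensor‖ ≤ b := by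
        intro t ht
        obtain ⟨u, hu, hu'⟩ := mem_closure_iff_seq_limit.1 hcl
        exact le_of_tendsto (tendsto_of_lipschitz (hLip' t (hsub ht))
          (fun j => Or.inl (subset_closure (hu j))) (Or.inl hcl) hu').norm
          (Filter.Eventually.of_forall fun j => hB' t (hsub ht) _ (hu j))
      -- `F` is not assumed bounded along the exact solution. Comparison with its value at `D k`
      -- through the Lipschitz condition gives linear growth, to which Gronwall applies.
      have hAd : ∀ t ∈ Icc t₀ t₁, ‖A t - A t₀‖ ≤ (l * e + b) * h * X₁ := by
        intro t ht
        have h1 := norm_sub_le_of_linear_growth hl0 (ε := l * e + b) (by positivity) hA'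
          (fun s hs => by
            have h1 := hL1 s hs _ hcl
            have h2 := hBcl s hs
            have h3 : ‖F s (A s)‖ ≤ ‖F s (D k).tensor‖ + ‖F s (D k).tensor - F s (A s)‖ := by
              have := norm_sub_norm_le (F s (A s)) (F s (D k).tensor)
              rw [norm_sub_rev] at this
              linarith
            have h4 : ‖(D k).tensor - A s‖ ≤ e + ‖A s - A t₀‖ := by
              have := norm_sub_le_norm_sub_add_norm_sub (D k).tensor (A t₀) (A s)
              rwa [norm_sub_rev (A t₀)] at this
            have h5 := mul_le_mul_of_nonneg_left h4 hl0
            linarith) t ht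
        refine h1.trans ?_
        have h6 : t - t₀ ≤ h := by linarith [ht.2]
        have h7 : 0 ≤ t - t₀ := by linarith [ht.1]
        rw [hX₁]
        gcongr
        exact h6.trans hhT
      -- The Lipschitz constant times a bound for `‖Y - A t‖`: the radius of the step, the current
      -- error, and the motion of the exact solution.
      set η := l * (K * (b * h) + e + (l * e + b) * h * X₁) with hη
      have hη0 : 0 ≤ η := by positivity
      have hηle : η ≤ a₁ * h + a₂ * e := by
        have h1 : l * e * h * X₁ ≤ l * e * T * X₁ := by gcongr
        have h2 : η = l * (K * (b * h) + e + b * h * X₁) + l * (l * e * h * X₁) := by rw [hη]; ring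
        have h3 : a₁ * h + a₂ * e = l * (K * (b * h) + e + b * h * X₁) + l * (l * e * T * X₁) := by
          rw [ha₁, ha₂]; ring
        rw [h2, h3]
        gcongr
      -- With the smallness assumption this leaves room `(K b + 1) h` below `ρ`, so the ball used in
      -- this step lies where tangency is known.
      have hegl : e ≤ X * δ + X * T * K * ε + X * T * K * a₁ * h := by
        refine hek.trans ?_
        have h1 : t₀ ≤ T := ht'.trans hkT
        calc Real.exp (K * a₂ * t₀) * (δ + t₀ * (K * (a₁ * h + ε))) ≤
            Real.exp (K * a₂ * T) * (δ + T * (K * (a₁ * h + ε))) := by gcongr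
          _ = X * δ + X * T * K * ε + X * T * K * a₁ * h := by rw [hX]; ring
      have hH : LocalHyp τ F (fun t => F t (A t)) t₀ t₁ (D k).tensor b η ε
          (K * (b * (t₁ - t₀))) := by
        refine localHyp_of_assumptions (L := l) (ρ := ρ)
          (fun t ht Y hY Z hZ => hLip' t (hsub ht) Y (Or.inl hY) Z (Or.inl hZ))
          (fun t ht => hB' t (hsub ht)) (fun t ht => htan t (hsub ht)) ?_ ?_
        · intro t ht2 Y hY hYR
          refine (hL1 t ht2 Y hY).trans ?_
          rw [hη]
          refine mul_le_mul_of_nonneg_left ?_ hl0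
          have h1 := norm_sub_le_norm_sub_add_norm_sub Y (D k).tensor (A t)
          have h2 := norm_sub_le_norm_sub_add_norm_sub (D k).tensor (A t₀) (A t)
          have h3 := hAd t ht2
          rw [norm_sub_rev] at h3
          rw [ht] at hYR
          linarith
        · have h1 := hα t₀ (hsub ⟨le_rfl, ht'⟩)
          have h2 := norm_sub_norm_le (D k).tensor (A t₀)
          rw [ht]
          linarith
      obtain ⟨hO', -, herr⟩ := step_local_error τ (hstep k (by omega)) ht' hne hOk hb0 hη0 hε hH hA'
      refine ⟨hO', ?_⟩
      have hcast : ((k + 1 : ℕ) : ℝ) = (k : ℝ) + 1 := by push_cast; ring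
      rw [hcast]
      refine discrete_gronwall_step (x := e) (by positivity) (by positivity) hh.le he0 hek ?_
      have h1 : (D (k + 1)).tensor - A t₁ = ((D (k + 1)).tensor - (D k).tensor - (A t₁ - A t₀)) +
          ((D k).tensor - A t₀) := by abel
      rw [← ht₁, h1]
      refine (norm_add_le _ _).trans ?_
      rw [ht] at herr
      have h2 : K * (h * (η + ε)) ≤ K * (h * (a₁ * h + a₂ * e + ε)) := by gcongr
      have h3 : e * (1 + K * a₂ * h) + h * (K * (a₁ * h + ε)) =
          e + K * (h * (a₁ * h + a₂ * e + ε)) := by ring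
      rw [h3]
      linarith
  obtain ⟨-, hN⟩ := main N le_rfl
  refine hN.trans ?_
  calc Real.exp (K * a₂ * (N * h)) * (δ + N * h * (K * (a₁ * h + ε))) ≤
      Real.exp (K * a₂ * T) * (δ + T * (K * (a₁ * h + ε))) := by gcongr
    _ = X * δ + X * T * K * ε + X * T * K * a₁ * h := by rw [hX]; ring
    _ ≤ X * δ + X * T * K * ε + (X * T * K * a₁ + K * b + 1) * h := by
      have : 0 ≤ (K * b + 1) * h := by positivity
      linarith
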